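/- Let $k\in\mathbb C$ with $\operatorname{Re}k>0$, let $\mathrm{sn},\mathrm{cn},\mathrm{dn}$ be the Jacobi elliptic functions with modulus $k$, let $K'=K'(k)=\int_0^{\pi/2}\bigl(1-(1-k^2)\sin^2\theta\bigr)^{-1/2}\,d\theta$ (principal square root), and let $k^{1/2}$ be a fixed square root of $k$. For $\gamma_e,\gamma_o,z_0\in\mathbb C$ put $z_n=z_0+2(\gamma_e+\gamma_o)n$ and $\hat z_n=z_n+\gamma_e+\gamma_o$ $(n\in\mathbb Z)$, and consider the RCG equation for $(x_n,y_n)_{n\in\mathbb Z}$: \begin{align*} &y_{n+1}\Bigl(k^2(\mathrm{cn}^2\gamma_e-\mathrm{cn}^2z_n)\,\mathrm{cn}z_n\,\mathrm{dn}z_n\,x_n^2y_n-(1-k^2\mathrm{sn}^4z_n)\,\mathrm{cn}\gamma_e\,\mathrm{dn}\gamma_e\,x_n+(1-k^2\mathrm{sn}^2\gamma_e\,\mathrm{sn}^2z_n)\,\mathrm{cn}z_n\,\mathrm{dn}z_n\,y_n\Bigr)\\ &\quad=(1-k^2\mathrm{sn}^4z_n)\,\mathrm{cn}\gamma_e\,\mathrm{dn}\gamma_e\,x_ny_n-(\mathrm{cn}^2\gamma_e-\mathrm{cn}^2z_n)\,\mathrm{cn}z_n\,\mathrm{dn}z_n-(1-k^2\mathrm{sn}^2\gamma_e\,\mathrm{sn}^2z_n)\,\mathrm{cn}z_n\,\mathrm{dn}z_n\,x_n^2,\\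 &x_{n+1}\Bigl(k^2(\mathrm{cn}^2\gamma_o-\mathrm{cn}^2\hat z_n)\,\mathrm{cn}\hat z_n\,\mathrm{dn}\hat z_n\,y_{n+1}^2x_n-(1-k^2\mathrm{sn}^4\hat z_n)\,\mathrm{cn}\gamma_o\,\mathrm{dn}\gamma_o\,y_{n+1}+(1-k^2\mathrm{sn}^2\gamma_o\,\mathrm{sn}^2\hat z_n)\,\mathrm{cn}\hat z_n\,\mathrm{dn}\hat z_n\,x_n\Bigr)\\ &\quad=(1-k^2\mathrm{sn}^4\hat z_n)\,\mathrm{cn}\gamma_o\,\mathrm{dn}\gamma_o\,y_{n+1}x_n-(\mathrm{cn}^2\gamma_o-\mathrm{cn}^2\hat z_n)\,\mathrm{cn}\hat z_n\,\mathrm{dn}\hat z_n-(1-k^2\mathrm{sn}^2\gamma_o\,\mathrm{sn}^2\hat z_n)\,\mathrm{cn}\hat z_n\,\mathrm{dn}\hat z_n\,y_{n+1}^2. \end{align*} Suppose that $\gamma_o=\mathrm iK'/2$ and that none of $\gamma_e$, $z_n$, $\hat z_n$ $(n\in\mathbb Z)$ is a pole of $\mathrm{sn},\mathrm{cn},\mathrm{dn}$.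 (a) The four pairs $(x_n,y_n)=\bigl(\varepsilon(-1)^nk^{-1/2},\ \delta(-1)^nk^{-1/2}\bigr)$ with $\varepsilon,\delta\in\{1,-1\}$ are solutions of the RCG equation. (b) Suppose in addition that $\mathrm{cn}\gamma_e\ne0$, $\mathrm{dn}\gamma_e\neq0$ and $1-k\,\mathrm{sn}^2z_n\ne0$ for all $n$, and put $$A_n=-\mathrm i\,\frac{(1-k\,\mathrm{sn}^2\gamma_e)\,\mathrm{cn}z_n\,\mathrm{dn}z_n}{\mathrm{cn}\gamma_e\,\mathrm{dn}\gamma_e\,(1-k\,\mathrm{sn}^2z_n)}.$$ If $(u_n)_{n\in\mathbb Z}$ is a solution, with $\cos u_n\neq0$ for all $n$, of the linear equation $$u_{n+1}+u_n=(-1)^n\arctan(A_n),$$ where for each $n$ any value of the multivalued $\arctan(A_n)$ may be taken, then $$(x_n,y_n)=\Bigl(\frac{(-1)^n}{k^{1/2}},\ \frac{\mathrm i\tan(u_n)}{k^{1/2}}\Bigr)\quad\text{and}\quad(x_n,y_n)=\Bigl(\frac{(-1)^{n+1}}{k^{1/2}},\ -\frac{\mathrm i\tan(u_n)}{k^{1/2}}\Bigr)$$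 are solutions of the RCG equation. -/

import Mathlib

set_option linter.unusedSimpArgs false

open Filter Topology

/-! ### The Jacobi elliptic functions with modulus `k`

`(sn, cn, dn)` is the unique triple of meromorphic functions on `ℂ` that solves
`sn' = cn dn`, `cn' = - sn dn`, `dn' = - k ^ 2 sn cn`, `sn 0 = 0`, `cn 0 = dn 0 = 1`.
Existence and uniqueness hold for every `k : ℂ` and are proved below; the definitions of
`jacobiSn`, `jacobiCn`, `jacobiDn` follow the proof. -/

/-- The system of differential equations of `(sn, cn, dn)` with modulus `k`, at the point `w`. -/
def JacobiODEAt (k : ℂ) (s c d : ℂ → ℂ) (w : ℂ) : Prop :=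
  HasDerivAt s (c w * d w) w ∧ HasDerivAt c (-(s w * d w)) w ∧
    HasDerivAt d (-(k ^ 2 * s w * c w)) w

/-- `(s, c, d)` are meromorphic functions on `U`, analytic at the origin, with the initial values
`(0, 1, 1)` there, and they solve the system away from isolated points (the poles). "Normal form"
is Mathlib's normalization of the values: a meromorphic function in normal form is analytic
wherever it has no pole, and has the value `0` at its poles. -/
structure IsJacobiOn (k : ℂ) (U : Set ℂ) (s c d : ℂ → ℂ) : Prop where
  nf : ∀ z ∈ U, MeromorphicNFAt s z ∧ MeromorphicNFAt c z ∧ MeromorphicNFAt d z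
  an : AnalyticAt ℂ s 0 ∧ AnalyticAt ℂ c 0 ∧ AnalyticAt ℂ d 0
  init : s 0 = 0 ∧ c 0 = 1 ∧ d 0 = 1
  ode : ∀ z ∈ U, ∀ᶠ w in 𝓝[≠] z, JacobiODEAt k s c d w

theorem hasDerivAt_of_punctured {f g : ℂ → ℂ} {z : ℂ} (hf : AnalyticAt ℂ f z)
    (hg : AnalyticAt ℂ g z) (h : ∀ᶠ w in 𝓝[≠] z, HasDerivAt f (g w) w) :
    HasDerivAt f (g z) z := by
  have h1 : deriv f =ᶠ[𝓝[≠] z] g := h.mono fun w hw => hw.deriv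
  have h2 : deriv f =ᶠ[𝓝 z] g :=
    (hf.deriv.continuousAt.eventuallyEq_nhds_iff_eventuallyEq_nhdsNE hg.continuousAt).1 h1
  exact h2.eq_of_nhds ▸ hf.differentiableAt.hasDerivAt

theorem IsJacobiOn.ode_nhds_zero {k : ℂ} {U : Set ℂ} {s c d : ℂ → ℂ}
    (h : IsJacobiOn k U s c d) (h0 : (0 : ℂ) ∈ U) : ∀ᶠ w in 𝓝 0, JacobiODEAt k s c d w := by
  obtain ⟨hs, hc, hd⟩ := h.an
  have h1 := h.ode 0 h0
  rw [eventually_nhdsWithin_iff] at h1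
  filter_upwards [h1] with w hw
  by_cases hw0 : w = 0
  · subst hw0
    exact ⟨hasDerivAt_of_punctured hs (hc.mul hd) ((h.ode 0 h0).mono fun w hw => hw.1),
      hasDerivAt_of_punctured hc (hs.mul hd).neg ((h.ode 0 h0).mono fun w hw => hw.2.1),
      hasDerivAt_of_punctured hd ((analyticAt_const.mul hs).mul hc).neg
        ((h.ode 0 h0).mono fun w hw => hw.2.2)⟩
  · exact hw hw0

/-- Identity theorem on a connected set, from the germ at the origin. -/
theorem punctured_zero_of_zero {f : ℂ → ℂ} {U : Set ℂ} (hU : IsPreconnected U)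
    (h0 : (0 : ℂ) ∈ U) (hf : ∀ z ∈ U, MeromorphicAt f z) (h : ∀ᶠ w in 𝓝 0, f w = 0)
    {z : ℂ} (hz : z ∈ U) : ∀ᶠ w in 𝓝[≠] z, f w = 0 := by
  rw [← meromorphicOrderAt_eq_top_iff]
  by_contra hne
  exact MeromorphicOn.meromorphicOrderAt_ne_top_of_isPreconnected (fun z hz => hf z hz) hU hz h0 hne
    (meromorphicOrderAt_eq_top_iff.2 (h.filter_mono nhdsWithin_le_nhds))

theorem punctured_ne_zero_of_ne_zero {f : ℂ → ℂ} {U : Set ℂ} (hU : IsPreconnected U)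
    (h0 : (0 : ℂ) ∈ U) (hf : ∀ z ∈ U, MeromorphicAt f z) (h : ∀ᶠ w in 𝓝 0, f w ≠ 0)
    {z : ℂ} (hz : z ∈ U) : ∀ᶠ w in 𝓝[≠] z, f w ≠ 0 := by
  rw [← meromorphicOrderAt_ne_top_iff_eventually_ne_zero (hf z hz)]
  exact MeromorphicOn.meromorphicOrderAt_ne_top_of_isPreconnected (fun z hz => hf z hz) hU h0 hz
    ((meromorphicOrderAt_ne_top_iff_eventually_ne_zero (hf 0 h0)).2
      (h.filter_mono nhdsWithin_le_nhds))

theorem IsJacobiOn.invariant_zero {k : ℂ} {U : Set ℂ} {s c d : ℂ → ℂ}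
    (h : IsJacobiOn k U s c d) (h0 : (0 : ℂ) ∈ U) :
    ∀ᶠ w in 𝓝 0, s w ^ 2 + c w ^ 2 - 1 = 0 ∧ d w ^ 2 + k ^ 2 * s w ^ 2 - 1 = 0 := by
  obtain ⟨r, hr, hb⟩ := Metric.eventually_nhds_iff_ball.1 (h.ode_nhds_zero h0)
  obtain ⟨hs0, hc0, hd0⟩ := h.init
  have key : ∀ g : ℂ → ℂ, (∀ w ∈ Metric.ball (0 : ℂ) r, HasDerivAt g 0 w) →
      ∀ w ∈ Metric.ball (0 : ℂ) r, g w = g 0 := fun g hg w hw =>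
    Metric.isOpen_ball.is_const_of_deriv_eq_zero (convex_ball _ _).isPreconnected
      (fun x hx => (hg x hx).differentiableAt.differentiableWithinAt)
      (fun x hx => (hg x hx).deriv) hw (Metric.mem_ball_self hr)
  filter_upwards [Metric.ball_mem_nhds (0 : ℂ) hr] with w hw
  constructor
  · rw [key (fun w => s w ^ 2 + c w ^ 2 - 1) ?_ w hw]
    · simp [hs0, hc0]
    · intro x hx
      obtain ⟨h1, h2, h3⟩ := hb x hx
      exact (((h1.pow 2).add (h2.pow 2)).sub_const 1).congr_deriv (by ring)
  · rw [key (fun w => d w ^ 2 + k ^ 2 * s w ^ 2 - 1) ?_ w hw]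
    · simp [hs0, hd0]
    · intro x hx
      obtain ⟨h1, h2, h3⟩ := hb x hx
      exact (((h3.pow 2).add ((h1.pow 2).const_mul (k ^ 2))).sub_const 1).congr_deriv (by ring)

theorem IsJacobiOn.mono {k : ℂ} {U V : Set ℂ} {s c d : ℂ → ℂ}
    (h : IsJacobiOn k U s c d) (hV : V ⊆ U) : IsJacobiOn k V s c d :=
  ⟨fun z hz => h.nf z (hV hz), h.an, h.init, fun z hz => h.ode z (hV hz)⟩

theorem IsJacobiOn.unique_zero {k : ℂ} {U : Set ℂ} {s c d s' c' d' : ℂ → ℂ} (h0 : (0 : ℂ) ∈ U)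
    (h : IsJacobiOn k U s c d) (h' : IsJacobiOn k U s' c' d') :
    s =ᶠ[𝓝 0] s' ∧ c =ᶠ[𝓝 0] c' ∧ d =ᶠ[𝓝 0] d' := by
  let v : ℂ × ℂ × ℂ → ℂ × ℂ × ℂ := fun p => (p.2.1 * p.2.2, -(p.1 * p.2.2), -(k ^ 2 * p.1 * p.2.1))
  have hv : ContDiffAt ℝ 1 v (0, 1, 1) := by
    apply ContDiff.contDiffAt; fun_prop
  obtain ⟨K, T, hT, hK⟩ := hv.exists_lipschitzOnWith
  have hof : Tendsto (fun t : ℝ => (t : ℂ)) (𝓝 0) (𝓝 0) := by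
    simpa using Complex.continuous_ofReal.tendsto 0
  have aux : ∀ {s c d : ℂ → ℂ}, IsJacobiOn k U s c d → ∀ᶠ t : ℝ in 𝓝 0,
      HasDerivAt (fun t : ℝ => (s t, c t, d t)) (v (s t, c t, d t)) t ∧ (s t, c t, d t) ∈ T := by
    intro s c d h
    have e1 : ContinuousAt (fun w => (s w, c w, d w)) 0 :=
      h.an.1.continuousAt.prodMk (h.an.2.1.continuousAt.prodMk h.an.2.2.continuousAt)
    have e2 : ∀ᶠ w in 𝓝 (0 : ℂ), (s w, c w, d w) ∈ T := by
      apply e1.eventually_mem; rw [h.init.1, h.init.2.1, h.init.2.2]; exact hT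
    filter_upwards [hof.eventually e2, hof.eventually (h.ode_nhds_zero h0)] with t h1 h2
    exact ⟨h2.1.comp_ofReal.prodMk (h2.2.1.comp_ofReal.prodMk h2.2.2.comp_ofReal), h1⟩
  have hreal := ODE_solution_unique_of_eventually (v := fun _ => v) (s := fun _ => T)
    (Eventually.of_forall fun _ => hK) (aux h) (aux h')
    (by simp [h.init.1, h.init.2.1, h.init.2.2, h'.init.1, h'.init.2.1, h'.init.2.2])
  have ext : ∀ {f g : ℂ → ℂ}, AnalyticAt ℂ f 0 → AnalyticAt ℂ g 0 →
      (∀ᶠ t : ℝ in 𝓝 0, f t = g t) → f =ᶠ[𝓝 0] g := by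
    intro f g hf hg hfg
    refine (hf.frequently_eq_iff_eventually_eq hg).1 ?_
    have ht : Tendsto (fun t : ℝ => (t : ℂ)) (𝓝[≠] 0) (𝓝[≠] 0) := by
      refine tendsto_nhdsWithin_iff.2 ⟨hof.mono_left nhdsWithin_le_nhds, ?_⟩
      filter_upwards [self_mem_nhdsWithin] with t ht
      simpa using ht
    exact ht.frequently (hfg.filter_mono nhdsWithin_le_nhds).frequently
  exact ⟨ext h.an.1 h'.an.1 (hreal.mono fun t ht => (Prod.ext_iff.1 ht).1),
    ext h.an.2.1 h'.an.2.1 (hreal.mono fun t ht => (Prod.ext_iff.1 (Prod.ext_iff.1 ht).2).1),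
    ext h.an.2.2 h'.an.2.2 (hreal.mono fun t ht => (Prod.ext_iff.1 (Prod.ext_iff.1 ht).2).2)⟩

theorem nf_eq_of_zero {f g : ℂ → ℂ} {U : Set ℂ} (hU : IsPreconnected U)
    (h0 : (0 : ℂ) ∈ U) (hf : ∀ z ∈ U, MeromorphicNFAt f z) (hg : ∀ z ∈ U, MeromorphicNFAt g z)
    (h : f =ᶠ[𝓝 0] g) {z : ℂ} (hz : z ∈ U) : f =ᶠ[𝓝 z] g := by
  rw [← (hf z hz).eventuallyEq_nhdsNE_iff_eventuallyEq_nhds (hg z hz)]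
  have := punctured_zero_of_zero (f := f - g) hU h0
    (fun z hz => (hf z hz).meromorphicAt.sub (hg z hz).meromorphicAt)
    (h.mono fun w hw => by simp [hw]) hz
  exact this.mono fun w hw => sub_eq_zero.1 hw

theorem IsJacobiOn.unique {k : ℂ} {U : Set ℂ} {s c d s' c' d' : ℂ → ℂ} (hU : IsPreconnected U)
    (h0 : (0 : ℂ) ∈ U) (h : IsJacobiOn k U s c d) (h' : IsJacobiOn k U s' c' d')
    {z : ℂ} (hz : z ∈ U) : s =ᶠ[𝓝 z] s' ∧ c =ᶠ[𝓝 z] c' ∧ d =ᶠ[𝓝 z] d' := by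
  obtain ⟨h1, h2, h3⟩ := h.unique_zero h0 h'
  exact ⟨nf_eq_of_zero hU h0 (fun z hz => (h.nf z hz).1) (fun z hz => (h'.nf z hz).1) h1 hz,
    nf_eq_of_zero hU h0 (fun z hz => (h.nf z hz).2.1) (fun z hz => (h'.nf z hz).2.1) h2 hz,
    nf_eq_of_zero hU h0 (fun z hz => (h.nf z hz).2.2) (fun z hz => (h'.nf z hz).2.2) h3 hz⟩

theorem exists_jacobi_germ (k : ℂ) : ∃ s c d : ℂ → ℂ, s 0 = 0 ∧ c 0 = 1 ∧ d 0 = 1 ∧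
    ∀ᶠ w in 𝓝 0, JacobiODEAt k s c d w := by
  -- a square root of `1 - q x ^ 2` near the origin
  have root : ∀ q : ℂ, ∃ a : ℂ → ℂ, a 0 = 1 ∧ (∀ x, a x ^ 2 = 1 - q * x ^ 2) ∧
      AnalyticAt ℂ a 0 := by
    intro q
    refine ⟨fun x => (1 - q * x ^ 2) ^ (((2 : ℕ) : ℂ)⁻¹), by simp,
      fun x => Complex.cpow_nat_inv_pow _ two_ne_zero, ?_⟩
    apply AnalyticAt.cpow (by fun_prop) (by fun_prop)
    simp
  obtain ⟨a, a0, ha, haa⟩ := root 1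
  obtain ⟨b, b0, hb, hba⟩ := root (k ^ 2)
  have hab : ∀ᶠ x in 𝓝 (0 : ℂ), AnalyticAt ℂ a x ∧ AnalyticAt ℂ b x ∧ a x ≠ 0 ∧ b x ≠ 0 :=
    haa.eventually_analyticAt.and (hba.eventually_analyticAt.and
      ((haa.continuousAt.eventually_ne (by simp [a0])).and
        (hba.continuousAt.eventually_ne (by simp [b0]))))
  obtain ⟨r, hr, hball⟩ := Metric.eventually_nhds_iff_ball.1 hab
  have hdiff : DifferentiableOn ℂ (fun x => (a x * b x)⁻¹) (Metric.ball 0 r) := by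
    intro x hx
    obtain ⟨h1, h2, h3, h4⟩ := hball x hx
    exact ((h1.differentiableAt.mul h2.differentiableAt).inv
      (mul_ne_zero h3 h4)).differentiableWithinAt
  obtain ⟨F, F0, hF⟩ := hdiff.isExactOn_ball.with_val_at 0 0
  have hFa : AnalyticAt ℂ F 0 := by
    refine DifferentiableOn.analyticAt (s := Metric.ball 0 r) ?_ (Metric.ball_mem_nhds _ hr)
    exact fun x hx => (hF x hx).differentiableAt.differentiableWithinAt
  have hF1 : HasStrictDerivAt F 1 0 := by
    have := hFa.hasStrictDerivAt
    rwa [(hF 0 (Metric.mem_ball_self hr)).deriv, a0, b0, mul_one, inv_one] at this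
  let e := (hF1.hasStrictFDerivAt_equiv one_ne_zero).toOpenPartialHomeomorph F
  have he : ∀ x, e x = F x := fun x => rfl
  have h0s : (0 : ℂ) ∈ e.source :=
    (hF1.hasStrictFDerivAt_equiv one_ne_zero).mem_toOpenPartialHomeomorph_source
  have h0t : (0 : ℂ) ∈ e.target := by
    have := e.map_source h0s
    rwa [he, F0] at this
  have hs0 : e.symm 0 = 0 := by
    have := e.left_inv h0s
    rwa [he, F0] at this
  have hcont : ContinuousAt e.symm 0 := e.symm.continuousAt h0t
  have hs : ∀ᶠ w in 𝓝 0, e.symm w ∈ Metric.ball (0 : ℂ) r := by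
    apply hcont.eventually_mem
    rw [hs0]; exact Metric.ball_mem_nhds _ hr
  refine ⟨e.symm, fun w => a (e.symm w), fun w => b (e.symm w), hs0, by simp [hs0, a0],
    by simp [hs0, b0], ?_⟩
  filter_upwards [hs, e.open_target.mem_nhds h0t] with w hw hwt
  obtain ⟨h1, h2, h3, h4⟩ := hball _ hw
  have hS : HasDerivAt e.symm (a (e.symm w) * b (e.symm w)) w := by
    have := e.hasDerivAt_symm hwt (inv_ne_zero (mul_ne_zero h3 h4)) (hF _ hw)
    rwa [inv_inv] at this
  have hder : ∀ (q : ℂ) (f : ℂ → ℂ), (∀ x, f x ^ 2 = 1 - q * x ^ 2) → ∀ x, f x ≠ 0 →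
      DifferentiableAt ℂ f x → HasDerivAt f (-(q * x) / f x) x := by
    intro q f hf x hx hfx
    have e1 := hfx.hasDerivAt.pow 2
    have e2 : HasDerivAt (fun x => 1 - q * x ^ 2) (-(q * (2 * x))) x := by
      simpa using ((hasDerivAt_pow 2 x).const_mul q).const_sub 1
    have e3 : (f ^ 2) = fun x => 1 - q * x ^ 2 := funext hf
    rw [e3] at e1
    have e4 := e1.unique e2
    refine hfx.hasDerivAt.congr_deriv ?_
    field_simp
    simp at e4
    linear_combination e4 / 2
  refine ⟨hS, ?_, ?_⟩
  · refine ((hder 1 a ha _ h3 h1.differentiableAt).comp w hS).congr_deriv ?_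
    field_simp
  · refine ((hder (k ^ 2) b hb _ h4 h2.differentiableAt).comp w hS).congr_deriv ?_
    field_simp

theorem exists_isJacobiOn_small (k : ℂ) : ∃ r > 0, ∃ s c d : ℂ → ℂ,
    IsJacobiOn k (Metric.ball 0 r) s c d := by
  obtain ⟨s, c, d, hs, hc, hd, h⟩ := exists_jacobi_germ k
  obtain ⟨r, hr, hb⟩ := Metric.eventually_nhds_iff_ball.1 h
  have an : ∀ z ∈ Metric.ball (0 : ℂ) r, AnalyticAt ℂ s z ∧ AnalyticAt ℂ c z ∧ AnalyticAt ℂ d z := by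
    intro z hz
    have hn := Metric.isOpen_ball.mem_nhds hz
    exact ⟨DifferentiableOn.analyticAt
        (fun x hx => (hb x hx).1.differentiableAt.differentiableWithinAt) hn,
      DifferentiableOn.analyticAt
        (fun x hx => (hb x hx).2.1.differentiableAt.differentiableWithinAt) hn,
      DifferentiableOn.analyticAt
        (fun x hx => (hb x hx).2.2.differentiableAt.differentiableWithinAt) hn⟩
  refine ⟨r, hr, s, c, d, fun z hz => ?_, an 0 (Metric.mem_ball_self hr), ⟨hs, hc, hd⟩,
    fun z hz => ?_⟩
  · obtain ⟨h1, h2, h3⟩ := an z hz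
    exact ⟨h1.meromorphicNFAt, h2.meromorphicNFAt, h3.meromorphicNFAt⟩
  · filter_upwards [nhdsWithin_le_nhds (Metric.isOpen_ball.mem_nhds hz)] with w hw using hb w hw

/-- The duplication formulas carry a solution on a disc to a solution on the doubled disc. -/
theorem IsJacobiOn.double {k : ℂ} {R : ℝ} (hR : 0 < R) {s c d : ℂ → ℂ}
    (h : IsJacobiOn k (Metric.ball 0 R) s c d) :
    ∃ s' c' d' : ℂ → ℂ, IsJacobiOn k (Metric.ball 0 (2 * R)) s' c' d' := by
  have hU : IsPreconnected (Metric.ball (0 : ℂ) R) := (convex_ball _ _).isPreconnected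
  have h0 : (0 : ℂ) ∈ Metric.ball (0 : ℂ) R := Metric.mem_ball_self hR
  let m : ℂ → ℂ := fun w => 1 - k ^ 2 * s w ^ 4
  let S : ℂ → ℂ := fun u => 2 * s (u / 2) * c (u / 2) * d (u / 2) / m (u / 2)
  let C : ℂ → ℂ := fun u => (c (u / 2) ^ 2 - s (u / 2) ^ 2 * d (u / 2) ^ 2) / m (u / 2)
  let D : ℂ → ℂ := fun u => (d (u / 2) ^ 2 - k ^ 2 * s (u / 2) ^ 2 * c (u / 2) ^ 2) / m (u / 2)
  have ms : ∀ z ∈ Metric.ball (0 : ℂ) R, MeromorphicAt s z := fun z hz => (h.nf z hz).1.meromorphicAt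
  have mc : ∀ z ∈ Metric.ball (0 : ℂ) R, MeromorphicAt c z :=
    fun z hz => (h.nf z hz).2.1.meromorphicAt
  have md : ∀ z ∈ Metric.ball (0 : ℂ) R, MeromorphicAt d z :=
    fun z hz => (h.nf z hz).2.2.meromorphicAt
  have mm : ∀ z ∈ Metric.ball (0 : ℂ) R, MeromorphicAt m z := fun z hz =>
    (MeromorphicAt.const 1 z).sub ((MeromorphicAt.const (k ^ 2) z).mul ((ms z hz).pow 4))
  have hm0 : m 0 ≠ 0 := by simp [m, h.init.1]
  have man : AnalyticAt ℂ m 0 := analyticAt_const.sub (analyticAt_const.mul (h.an.1.pow 4))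
  have mne : ∀ z ∈ Metric.ball (0 : ℂ) R, ∀ᶠ w in 𝓝[≠] z, m w ≠ 0 := fun z hz =>
    punctured_ne_zero_of_ne_zero hU h0 mm (man.continuousAt.eventually_ne hm0) hz
  have inv1 : ∀ z ∈ Metric.ball (0 : ℂ) R, ∀ᶠ w in 𝓝[≠] z, s w ^ 2 + c w ^ 2 - 1 = 0 :=
    fun z hz => punctured_zero_of_zero (f := fun w => s w ^ 2 + c w ^ 2 - 1) hU h0
      (fun z hz => (((ms z hz).pow 2).add ((mc z hz).pow 2)).sub (MeromorphicAt.const 1 z))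
      ((h.invariant_zero h0).mono fun w hw => hw.1) hz
  have inv2 : ∀ z ∈ Metric.ball (0 : ℂ) R, ∀ᶠ w in 𝓝[≠] z, d w ^ 2 + k ^ 2 * s w ^ 2 - 1 = 0 :=
    fun z hz => punctured_zero_of_zero (f := fun w => d w ^ 2 + k ^ 2 * s w ^ 2 - 1) hU h0
      (fun z hz => (((md z hz).pow 2).add
        ((MeromorphicAt.const (k ^ 2) z).mul ((ms z hz).pow 2))).sub (MeromorphicAt.const 1 z))
      ((h.invariant_zero h0).mono fun w hw => hw.2) hz
  have half : ∀ z ∈ Metric.ball (0 : ℂ) (2 * R), z / 2 ∈ Metric.ball (0 : ℂ) R := by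
    intro z hz
    rw [mem_ball_zero_iff] at hz ⊢
    rw [norm_div, Complex.norm_ofNat]; linarith
  have hhan : ∀ z : ℂ, AnalyticAt ℂ (fun u : ℂ => u / 2) z := fun z => by fun_prop
  have comp : ∀ {f : ℂ → ℂ}, (∀ z ∈ Metric.ball (0 : ℂ) R, MeromorphicAt f z) →
      ∀ z ∈ Metric.ball (0 : ℂ) (2 * R), MeromorphicAt (fun u => f (u / 2)) z :=
    fun hf z hz => MeromorphicAt.comp_analyticAt (hf _ (half z hz)) (hhan z)
  have htend : ∀ z : ℂ, Tendsto (fun u : ℂ => u / 2) (𝓝[≠] z) (𝓝[≠] (z / 2)) := by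
    intro z
    refine tendsto_nhdsWithin_iff.2
      ⟨((hhan z).continuousAt.tendsto).mono_left nhdsWithin_le_nhds, ?_⟩
    filter_upwards [self_mem_nhdsWithin] with u hu hcon
    apply hu
    have : u / 2 = z / 2 := hcon
    have h2 : u = z := by linear_combination 2 * this
    exact h2
  have mS : MeromorphicOn S (Metric.ball 0 (2 * R)) := fun z hz =>
    ((((MeromorphicAt.const 2 z).mul (comp ms z hz)).mul (comp mc z hz)).mul (comp md z hz)).div
      (comp mm z hz)
  have mC : MeromorphicOn C (Metric.ball 0 (2 * R)) := fun z hz =>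
    (((comp mc z hz).pow 2).sub (((comp ms z hz).pow 2).mul ((comp md z hz).pow 2))).div
      (comp mm z hz)
  have mD : MeromorphicOn D (Metric.ball 0 (2 * R)) := fun z hz =>
    (((comp md z hz).pow 2).sub (((MeromorphicAt.const (k ^ 2) z).mul
      ((comp ms z hz).pow 2)).mul ((comp mc z hz).pow 2))).div (comp mm z hz)
  have h02 : (0 : ℂ) ∈ Metric.ball (0 : ℂ) (2 * R) := Metric.mem_ball_self (by linarith)
  have ode : ∀ z ∈ Metric.ball (0 : ℂ) (2 * R), ∀ᶠ w in 𝓝[≠] z, JacobiODEAt k S C D w := by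
    intro z hz
    have hz2 := half z hz
    filter_upwards [(htend z).eventually (h.ode _ hz2), (htend z).eventually (mne _ hz2),
      (htend z).eventually (inv1 _ hz2), (htend z).eventually (inv2 _ hz2)] with w h1 h2 h3 h4
    obtain ⟨ds, dc, dd⟩ := h1
    have hh : HasDerivAt (fun u : ℂ => u / 2) (1 / 2) w := (hasDerivAt_id w).div_const 2
    have ds' := ds.comp w hh
    have dc' := dc.comp w hh
    have dd' := dd.comp w hh
    have dm' := ((ds'.pow 4).const_mul (k ^ 2)).const_sub 1
    have hc2 : c (w / 2) ^ 2 = 1 - s (w / 2) ^ 2 := by linear_combination h3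
    have hd2 : d (w / 2) ^ 2 = 1 - k ^ 2 * s (w / 2) ^ 2 := by linear_combination h4
    have h2' : 1 - k ^ 2 * s (w / 2) ^ 4 ≠ 0 := h2
    refine ⟨?_, ?_, ?_⟩
    · refine ((((ds'.const_mul 2).mul dc').mul dd').div dm' h2').congr_deriv ?_
      simp only [C, D, m, Function.comp_apply, Pi.mul_apply, Pi.pow_apply]
      generalize s (w / 2) = x at *
      generalize c (w / 2) = y at *
      generalize d (w / 2) = t at *
      field_simp
      push_cast
      have y3 : y ^ 3 = y * (1 - x ^ 2) := by rw [← hc2]; ring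
      have y4 : y ^ 4 = (1 - x ^ 2) ^ 2 := by rw [← hc2]; ring
      have t3 : t ^ 3 = t * (1 - k ^ 2 * x ^ 2) := by rw [← hd2]; ring
      have t4 : t ^ 4 = (1 - k ^ 2 * x ^ 2) ^ 2 := by rw [← hd2]; ring
      ring_nf
      simp only [hc2, hd2, y3, y4, t3, t4]
      ring
    · refine (((dc'.pow 2).sub ((ds'.pow 2).mul (dd'.pow 2))).div dm' h2').congr_deriv ?_
      simp only [S, D, m, Function.comp_apply, Pi.mul_apply, Pi.pow_apply, Pi.sub_apply]
      generalize s (w / 2) = x at *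
      generalize c (w / 2) = y at *
      generalize d (w / 2) = t at *
      field_simp
      push_cast
      have y3 : y ^ 3 = y * (1 - x ^ 2) := by rw [← hc2]; ring
      have y4 : y ^ 4 = (1 - x ^ 2) ^ 2 := by rw [← hc2]; ring
      have t3 : t ^ 3 = t * (1 - k ^ 2 * x ^ 2) := by rw [← hd2]; ring
      have t4 : t ^ 4 = (1 - k ^ 2 * x ^ 2) ^ 2 := by rw [← hd2]; ring
      ring_nf
      simp only [hc2, hd2, y3, y4, t3, t4]
      ring
    · refine (((dd'.pow 2).sub (((ds'.pow 2).const_mul (k ^ 2)).mul (dc'.pow 2))).div dm' h2').congr_deriv ?_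
      simp only [S, C, m, Function.comp_apply, Pi.mul_apply, Pi.pow_apply, Pi.sub_apply]
      generalize s (w / 2) = x at *
      generalize c (w / 2) = y at *
      generalize d (w / 2) = t at *
      field_simp
      push_cast
      have y3 : y ^ 3 = y * (1 - x ^ 2) := by rw [← hc2]; ring
      have y4 : y ^ 4 = (1 - x ^ 2) ^ 2 := by rw [← hc2]; ring
      have t3 : t ^ 3 = t * (1 - k ^ 2 * x ^ 2) := by rw [← hd2]; ring
      have t4 : t ^ 4 = (1 - k ^ 2 * x ^ 2) ^ 2 := by rw [← hd2]; ring
      ring_nf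
      simp only [hc2, hd2, y3, y4, t3, t4]
      ring
  have an0 : ∀ {f : ℂ → ℂ}, AnalyticAt ℂ f 0 → AnalyticAt ℂ (fun u => f (u / 2)) 0 := by
    intro f hf
    refine AnalyticAt.fun_comp ?_ (hhan 0)
    simpa using hf
  have hm02 : (fun u => m (u / 2)) 0 ≠ 0 := by simpa using hm0
  have aS : AnalyticAt ℂ S 0 :=
    (((analyticAt_const.mul (an0 h.an.1)).mul (an0 h.an.2.1)).mul (an0 h.an.2.2)).div (an0 man) hm02
  have aC : AnalyticAt ℂ C 0 :=
    (((an0 h.an.2.1).pow 2).sub (((an0 h.an.1).pow 2).mul ((an0 h.an.2.2).pow 2))).div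
      (an0 man) hm02
  have aD : AnalyticAt ℂ D 0 :=
    (((an0 h.an.2.2).pow 2).sub ((analyticAt_const.mul ((an0 h.an.1).pow 2)).mul
      ((an0 h.an.2.1).pow 2))).div (an0 man) hm02
  have nfz : ∀ {f : ℂ → ℂ}, MeromorphicOn f (Metric.ball 0 (2 * R)) → AnalyticAt ℂ f 0 →
      f =ᶠ[𝓝 0] toMeromorphicNFOn f (Metric.ball 0 (2 * R)) := by
    intro f hf hfa
    rw [← hfa.meromorphicNFAt.eventuallyEq_nhdsNE_iff_eventuallyEq_nhds
      (meromorphicNFOn_toMeromorphicNFOn f _ h02)]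
    exact (hf.toMeromorphicNFOn_eq_self_on_nhdsNE h02).symm
  refine ⟨toMeromorphicNFOn S (Metric.ball 0 (2 * R)), toMeromorphicNFOn C (Metric.ball 0 (2 * R)),
    toMeromorphicNFOn D (Metric.ball 0 (2 * R)), fun z hz =>
    ⟨meromorphicNFOn_toMeromorphicNFOn S _ hz, meromorphicNFOn_toMeromorphicNFOn C _ hz,
      meromorphicNFOn_toMeromorphicNFOn D _ hz⟩,
    ⟨aS.congr (nfz mS aS), aC.congr (nfz mC aC), aD.congr (nfz mD aD)⟩, ⟨?_, ?_, ?_⟩, ?_⟩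
  · rw [← (nfz mS aS).eq_of_nhds]; simp [S, h.init.1]
  · rw [← (nfz mC aC).eq_of_nhds]; simp [C, m, h.init.1, h.init.2.1]
  · rw [← (nfz mD aD).eq_of_nhds]; simp [D, m, h.init.1, h.init.2.2]
  · intro z hz
    have ev : ∀ {f : ℂ → ℂ}, MeromorphicOn f (Metric.ball 0 (2 * R)) →
        ∀ᶠ w in 𝓝[≠] z, f =ᶠ[𝓝 w] toMeromorphicNFOn f (Metric.ball 0 (2 * R)) := by
      intro f hf
      have := (hf.toMeromorphicNFOn_eq_self_on_nhdsNE hz).symm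
      exact eventually_eventually_nhdsWithin.2 this |>.and self_mem_nhdsWithin |>.mono
        fun w hw => by
          have := hw.1
          rwa [(isOpen_compl_singleton.nhdsWithin_eq hw.2)] at this
    filter_upwards [ode z hz, ev mS, ev mC, ev mD] with w h1 h2 h3 h4
    obtain ⟨ds, dc, dd⟩ := h1
    refine ⟨?_, ?_, ?_⟩
    · rw [← h3.eq_of_nhds, ← h4.eq_of_nhds]; exact ds.congr_of_eventuallyEq h2.symm
    · rw [← h2.eq_of_nhds, ← h4.eq_of_nhds]; exact dc.congr_of_eventuallyEq h3.symm
    · rw [← h2.eq_of_nhds, ← h3.eq_of_nhds]; exact dd.congr_of_eventuallyEq h4.symm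

theorem existsUnique_isJacobiOn (k : ℂ) : ∃! p : (ℂ → ℂ) × (ℂ → ℂ) × (ℂ → ℂ),
    IsJacobiOn k Set.univ p.1 p.2.1 p.2.2 := by
  obtain ⟨r, hr, hsmall⟩ := exists_isJacobiOn_small k
  have hpos : ∀ n : ℕ, 0 < 2 ^ n * r := fun n => by positivity
  have hn : ∀ n : ℕ, ∃ s c d : ℂ → ℂ, IsJacobiOn k (Metric.ball 0 (2 ^ n * r)) s c d := by
    intro n
    induction n with
    | zero => simpa using hsmall
    | succ n ih =>
      obtain ⟨s, c, d, h⟩ := ih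
      have := h.double (hpos n)
      rwa [← mul_assoc, ← pow_succ'] at this
  choose s c d h using hn
  have hcov : ∀ z : ℂ, ∃ n : ℕ, z ∈ Metric.ball (0 : ℂ) (2 ^ n * r) := by
    intro z
    obtain ⟨n, hn⟩ := pow_unbounded_of_one_lt (‖z‖ / r) one_lt_two
    exact ⟨n, by rw [mem_ball_zero_iff]; exact (div_lt_iff₀ hr).1 hn⟩
  choose N hN using hcov
  have hle : ∀ {i j : ℕ}, i ≤ j → ∀ z ∈ Metric.ball (0 : ℂ) (2 ^ i * r),
      s i =ᶠ[𝓝 z] s j ∧ c i =ᶠ[𝓝 z] c j ∧ d i =ᶠ[𝓝 z] d j := by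
    intro i j hij z hz
    refine (h i).unique (convex_ball _ _).isPreconnected (Metric.mem_ball_self (hpos i))
      ((h j).mono (Metric.ball_subset_ball ?_)) hz
    gcongr
    exact one_le_two
  have hagree : ∀ (i j : ℕ) (z : ℂ), z ∈ Metric.ball (0 : ℂ) (2 ^ i * r) →
      z ∈ Metric.ball (0 : ℂ) (2 ^ j * r) → s i z = s j z ∧ c i z = c j z ∧ d i z = d j z := by
    intro i j z hi hj
    rcases le_total i j with hij | hij
    · obtain ⟨h1, h2, h3⟩ := hle hij z hi
      exact ⟨h1.eq_of_nhds, h2.eq_of_nhds, h3.eq_of_nhds⟩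
    · obtain ⟨h1, h2, h3⟩ := hle hij z hj
      exact ⟨h1.eq_of_nhds.symm, h2.eq_of_nhds.symm, h3.eq_of_nhds.symm⟩
  have hloc : ∀ n : ℕ, ∀ z ∈ Metric.ball (0 : ℂ) (2 ^ n * r),
      s n =ᶠ[𝓝 z] (fun w => s (N w) w) ∧ c n =ᶠ[𝓝 z] (fun w => c (N w) w) ∧
        d n =ᶠ[𝓝 z] (fun w => d (N w) w) := by
    intro n z hz
    have hz' := Metric.isOpen_ball.mem_nhds hz
    exact ⟨by filter_upwards [hz'] with w hw using (hagree _ _ w hw (hN w)).1,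
      by filter_upwards [hz'] with w hw using (hagree _ _ w hw (hN w)).2.1,
      by filter_upwards [hz'] with w hw using (hagree _ _ w hw (hN w)).2.2⟩
  obtain ⟨l1, l2, l3⟩ := hloc 0 0 (Metric.mem_ball_self (hpos 0))
  refine ⟨(fun w => s (N w) w, fun w => c (N w) w, fun w => d (N w) w), ⟨?_, ?_, ?_, ?_⟩, ?_⟩
  · intro z _
    obtain ⟨h1, h2, h3⟩ := hloc (N z) z (hN z)
    obtain ⟨n1, n2, n3⟩ := (h (N z)).nf z (hN z)
    exact ⟨(meromorphicNFAt_congr h1).1 n1, (meromorphicNFAt_congr h2).1 n2,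
      (meromorphicNFAt_congr h3).1 n3⟩
  · exact ⟨(h 0).an.1.congr l1, (h 0).an.2.1.congr l2, (h 0).an.2.2.congr l3⟩
  · obtain ⟨i1, i2, i3⟩ := (h 0).init
    exact ⟨l1.eq_of_nhds.symm.trans i1, l2.eq_of_nhds.symm.trans i2, l3.eq_of_nhds.symm.trans i3⟩
  · intro z _
    have hz := Metric.isOpen_ball.mem_nhds (hN z)
    filter_upwards [(h (N z)).ode z (hN z), nhdsWithin_le_nhds hz] with w hw hwb
    obtain ⟨h1, h2, h3⟩ := hloc (N z) w hwb
    obtain ⟨ds, dc, dd⟩ := hw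
    refine ⟨?_, ?_, ?_⟩
    · exact (ds.congr_of_eventuallyEq h1.symm).congr_deriv (by rw [h2.eq_of_nhds, h3.eq_of_nhds])
    · exact (dc.congr_of_eventuallyEq h2.symm).congr_deriv (by rw [h1.eq_of_nhds, h3.eq_of_nhds])
    · exact (dd.congr_of_eventuallyEq h3.symm).congr_deriv (by rw [h1.eq_of_nhds, h2.eq_of_nhds])
  · rintro ⟨s', c', d'⟩ h'
    have key : ∀ z, s' z = s (N z) z ∧ c' z = c (N z) z ∧ d' z = d (N z) z := by
      intro z
      obtain ⟨h1, h2, h3⟩ := (h (N z)).unique (convex_ball _ _).isPreconnected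
        (Metric.mem_ball_self (hpos _)) (h'.mono (Set.subset_univ _)) (hN z)
      exact ⟨h1.eq_of_nhds.symm, h2.eq_of_nhds.symm, h3.eq_of_nhds.symm⟩
    exact Prod.ext (funext fun z => (key z).1)
      (Prod.ext (funext fun z => (key z).2.1) (funext fun z => (key z).2.2))

/-- The Jacobi elliptic function `sn` with modulus `k`. -/
noncomputable def jacobiSn (k : ℂ) : ℂ → ℂ := (existsUnique_isJacobiOn k).choose.1

/-- The Jacobi elliptic function `cn` with modulus `k`. -/
noncomputable def jacobiCn (k : ℂ) : ℂ → ℂ := (existsUnique_isJacobiOn k).choose.2.1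

/-- The Jacobi elliptic function `dn` with modulus `k`. -/
noncomputable def jacobiDn (k : ℂ) : ℂ → ℂ := (existsUnique_isJacobiOn k).choose.2.2

theorem isJacobiOn_jacobi (k : ℂ) :
    IsJacobiOn k Set.univ (jacobiSn k) (jacobiCn k) (jacobiDn k) :=
  (existsUnique_isJacobiOn k).choose_spec.1

/-- `u` is not a pole of `sn`, `cn`, `dn`. -/
def JacobiRegularAt (k u : ℂ) : Prop :=
  AnalyticAt ℂ (jacobiSn k) u ∧ AnalyticAt ℂ (jacobiCn k) u ∧ AnalyticAt ℂ (jacobiDn k) u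

/-! ### Complete elliptic integrals -/

/-- The complete elliptic integral of the first kind `K(k)`, with the principal square root. -/
noncomputable def completeEllipticK (k : ℂ) : ℂ :=
  ∫ θ in (0 : ℝ)..(Real.pi / 2), 1 / (1 - k ^ 2 * (Real.sin θ : ℂ) ^ 2) ^ (1 / 2 : ℂ)

/-- `K'(k) = K(k')` with the complementary modulus `k' = (1 - k ^ 2) ^ (1 / 2)`. -/
noncomputable def completeEllipticK' (k : ℂ) : ℂ :=
  completeEllipticK ((1 - k ^ 2) ^ (1 / 2 : ℂ))

/-! ### The elliptic difference equation -/

/-- `z_n = z_0 + 2 (γ_e + γ_o) n`. -/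
noncomputable def rcgZ (γe γo z0 : ℂ) (n : ℤ) : ℂ := z0 + 2 * (γe + γo) * n

/-- The common form of the two equations of the system, for the parameter `γ` and the argument `z`:
the first one is the case `γ = γ_e`, `z = z_n`, `(X, Y, Y') = (x_n, y_n, y_{n+1})`, the second one
the case `γ = γ_o`, `z = z_n + γ_e + γ_o`, `(X, Y, Y') = (y_{n+1}, x_n, x_{n+1})`. -/
def RCGRelation (k γ z X Y Y' : ℂ) : Prop :=
  Y' * (k ^ 2 * (jacobiCn k γ ^ 2 - jacobiCn k z ^ 2) * jacobiCn k z * jacobiDn k z * X ^ 2 * Y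
      - (1 - k ^ 2 * jacobiSn k z ^ 4) * jacobiCn k γ * jacobiDn k γ * X
      + (1 - k ^ 2 * jacobiSn k γ ^ 2 * jacobiSn k z ^ 2) * jacobiCn k z * jacobiDn k z * Y)
    = (1 - k ^ 2 * jacobiSn k z ^ 4) * jacobiCn k γ * jacobiDn k γ * X * Y
      - (jacobiCn k γ ^ 2 - jacobiCn k z ^ 2) * jacobiCn k z * jacobiDn k z
      - (1 - k ^ 2 * jacobiSn k γ ^ 2 * jacobiSn k z ^ 2) * jacobiCn k z * jacobiDn k z * X ^ 2

/-- `(x_n, y_n)` solves the elliptic difference equation of Ramani, Carstea and Grammaticos. -/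
def IsRCGSolution (k γe γo z0 : ℂ) (x y : ℤ → ℂ) : Prop :=
  ∀ n : ℤ,
    RCGRelation k γe (rcgZ γe γo z0 n) (x n) (y n) (y (n + 1)) ∧
    RCGRelation k γo (rcgZ γe γo z0 n + γe + γo) (y (n + 1)) (x n) (x (n + 1))

/-- `A_n = - i (1 - k sn(γ_e)^2) cn(z_n) dn(z_n) / (cn(γ_e) dn(γ_e) (1 - k sn(z_n)^2))`. -/
noncomputable def rcgA (k γe γo z0 : ℂ) (n : ℤ) : ℂ :=
  -Complex.I * ((1 - k * jacobiSn k γe ^ 2) * jacobiCn k (rcgZ γe γo z0 n)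
      * jacobiDn k (rcgZ γe γo z0 n))
    / (jacobiCn k γe * jacobiDn k γe * (1 - k * jacobiSn k (rcgZ γe γo z0 n) ^ 2))

/-- `w` is a value (on any branch) of the inverse tangent of `a`. -/
def IsArctanValue (a w : ℂ) : Prop := Complex.cos w ≠ 0 ∧ Complex.tan w = a

/-! Write $P=\mathrm{cn}^2\gamma-\mathrm{cn}^2z=\mathrm{sn}^2z-\mathrm{sn}^2\gamma$ and
$S=1-k^2\mathrm{sn}^2\gamma\,\mathrm{sn}^2z$. Both equations have the shape `RCGRelation`, and three
algebraic facts about it give the theorem. If $X^2=Y^2=1/k$, then $Y'=-Y$ solves it identically in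
$\gamma$ and $z$; this is (a) (`rcgRelation_of_sq_eq`). If $k\,\mathrm{sn}^2\gamma=-1$, then $kP=S$,
and $Y'=-Y$ with $kY^2=1$ solves it for every $X$ (`rcgRelation_of_sn_sq`). So at $\gamma_o$ the
sequence $x_n=\pm(-1)^nk^{-1/2}$ satisfies the second equation whatever $y$ is. If $kX^2=1$, the
relation follows from one bilinear in $Y,Y'$ (`rcgRelation_of_bilinear`). For $y_n=\mathrm
i\tan(u_n)k^{-1/2}$ this is the tangent addition formula for $\tan(u_{n+1}+u_n)=(-1)^nA_n$, which
gives (b).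

The analytic content is $k\,\mathrm{sn}^2(\mathrm iK'/2)=-1$ for complex $k$, with $K'$ given by its
integral (`jacobiSn_half_completeEllipticK'`). Let
$V(t)=\int_0^t((1+\tau^2)(1+k^2\tau^2))^{-1/2}d\tau$. Then $\mathrm{sn}(\mathrm iV(t))=\mathrm it$:
near $0$ by the differential equations, elsewhere by the identity theorem. The involution
$t\mapsto1/(kt)$ reverses the sign of the differential $V'(t)\,dt$, so $V(t)+V(1/(kt))$ is constant
on a cone; letting $t\to+\infty$ with $t=\tan\theta$ identifies the constant as $K'$. The fixed
point $t=k^{-1/2}$ has $V(t)=K'/2$, hence $\mathrm{sn}(\mathrm iK'/2)=\mathrm ik^{-1/2}$. -/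

/-! ### Primitives and removal of poles. -/

/-- On an open star-shaped set, a holomorphic function has a primitive. -/
theorem exists_primitive_of_starConvex {D : Set ℂ} (hD : IsOpen D) (hstar : StarConvex ℝ 0 D)
    {h : ℂ → ℂ} (hh : DifferentiableOn ℂ h D) :
    ∃ V : ℂ → ℂ, V 0 = 0 ∧ ∀ t ∈ D, HasDerivAt V (h t) t := by
  -- Integral of $h$ along the segment from $0$ to $x$. Its integrand has $x$-derivative $h(\tau
  -- x)+\tau x\,h'(\tau x)=\frac{d}{d\tau}(\tau h(\tau x))$, which integrates to $h(x)$.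
  refine ⟨fun x => ∫ τ in (0 : ℝ)..1, x * h (τ * x), by simp, fun t ht => ?_⟩
  have mem : ∀ x ∈ D, ∀ τ ∈ Set.Icc (0 : ℝ) 1, (τ : ℂ) * x ∈ D := fun x hx τ hτ => by
    simpa using hstar.smul_mem hx hτ.1 hτ.2
  have hd : ∀ x ∈ D, HasDerivAt h (deriv h x) x := fun x hx =>
    (hh.differentiableAt (hD.mem_nhds hx)).hasDerivAt
  have hc : ContinuousOn h D := hh.continuousOn
  have hc' : ContinuousOn (deriv h) D := (hh.deriv hD).continuousOn
  obtain ⟨r, hr, hrD⟩ := Metric.nhds_basis_closedBall.mem_iff.1 (hD.mem_nhds ht)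
  have maps : Set.MapsTo (fun p : ℂ × ℝ => (p.2 : ℂ) * p.1)
      (Metric.closedBall t r ×ˢ Set.Icc (0 : ℝ) 1) D :=
    fun p hp => mem _ (hrD hp.1) _ hp.2
  have cm : ContinuousOn (fun p : ℂ × ℝ => (p.2 : ℂ) * p.1)
      (Metric.closedBall t r ×ˢ Set.Icc (0 : ℝ) 1) := by fun_prop
  have cF : ContinuousOn (fun p : ℂ × ℝ => p.1 * h (p.2 * p.1))
      (Metric.closedBall t r ×ˢ Set.Icc (0 : ℝ) 1) :=
    continuousOn_fst.mul (hc.comp cm maps)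
  have cF' : ContinuousOn (fun p : ℂ × ℝ => h (p.2 * p.1) + p.1 * (deriv h (p.2 * p.1) * p.2))
      (Metric.closedBall t r ×ˢ Set.Icc (0 : ℝ) 1) :=
    (hc.comp cm maps).add (continuousOn_fst.mul ((hc'.comp cm maps).mul (by fun_prop)))
  obtain ⟨M, hM⟩ := ((isCompact_closedBall t r).prod isCompact_Icc).exists_bound_of_continuousOn cF'
  have slice : ∀ {f : ℂ × ℝ → ℂ}, ContinuousOn f (Metric.closedBall t r ×ˢ Set.Icc (0 : ℝ) 1) →
      ∀ x ∈ Metric.closedBall t r, ContinuousOn (fun τ => f (x, τ)) (Set.uIcc 0 1) := by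
    intro f hf x hx
    rw [Set.uIcc_of_le zero_le_one]
    exact hf.comp (by fun_prop) fun τ hτ => ⟨hx, hτ⟩
  have htr : t ∈ Metric.closedBall t r := Metric.mem_closedBall_self hr.le
  have sub : Set.uIoc (0 : ℝ) 1 ⊆ Set.Icc 0 1 := by
    rw [Set.uIoc_of_le zero_le_one]; exact Set.Ioc_subset_Icc_self
  have main := (intervalIntegral.hasDerivAt_integral_of_dominated_loc_of_deriv_le
    (μ := MeasureTheory.volume) (a := 0) (b := 1) (𝕜 := ℂ)
    (F := fun x τ => x * h (τ * x)) (F' := fun x τ => h (τ * x) + x * (deriv h (τ * x) * τ))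
    (x₀ := t) (bound := fun _ => M) (Metric.closedBall_mem_nhds t hr) ?_
    (slice cF t htr).intervalIntegrable
    (slice cF' t htr).intervalIntegrable.aestronglyMeasurable_restrict_uIoc ?_ (by simp) ?_).2
  · refine main.congr_deriv ?_
    have ftc := intervalIntegral.integral_eq_sub_of_hasDerivAt (a := 0) (b := 1)
      (f := fun τ : ℝ => (τ : ℂ) * h (τ * t))
      (f' := fun τ : ℝ => h (τ * t) + t * (deriv h (τ * t) * τ)) ?_
      (slice cF' t htr).intervalIntegrable
    · simpa using ftc
    · intro τ hτ
      rw [Set.uIcc_of_le zero_le_one] at hτ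
      have e1 : HasDerivAt (fun z : ℂ => z * h (z * t))
          (1 * h (τ * t) + τ * (deriv h (τ * t) * (1 * t))) (τ : ℂ) :=
        (hasDerivAt_id _).mul ((hd _ (mem t ht τ hτ)).comp (τ : ℂ) ((hasDerivAt_id _).mul_const t))
      exact e1.comp_ofReal.congr_deriv (by ring)
  · filter_upwards [Metric.closedBall_mem_nhds t hr] with x hx
    exact (slice cF x hx).intervalIntegrable.aestronglyMeasurable_restrict_uIoc
  · exact .of_forall fun τ hτ x hx => hM (x, τ) ⟨hx, sub hτ⟩
  · refine .of_forall fun τ hτ x hx => ?_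
    have e1 : HasDerivAt (fun z : ℂ => z * h (τ * z))
        (1 * h (τ * x) + x * (deriv h (τ * x) * (τ * 1))) x :=
      (hasDerivAt_id _).mul ((hd _ (mem x (hrD hx) τ (sub hτ))).comp x
        ((hasDerivAt_id _).const_mul (τ : ℂ)))
    exact e1.congr_deriv (by ring)

/-- If a meromorphic function in normal form agrees with an analytic function after a local change
of coordinates, then it has no pole. -/
theorem MeromorphicNFAt.analyticAt_and_eq_of_comp {f g φ : ℂ → ℂ} {t : ℂ}
    (hf : MeromorphicNFAt f (g t)) (hg : AnalyticAt ℂ g t) (hg' : deriv g t ≠ 0)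
    (hφ : AnalyticAt ℂ φ t) (h : f ∘ g =ᶠ[𝓝[≠] t] φ) :
    AnalyticAt ℂ f (g t) ∧ f (g t) = φ t := by
  have h1 : f ∘ g =ᶠ[𝓝 t] φ :=
    (((meromorphicNFAt_comp_iff_of_deriv_ne_zero hg hg').2 hf).eventuallyEq_nhdsNE_iff_eventuallyEq_nhds
      hφ.meromorphicNFAt).1 h
  exact ⟨(analyticAt_comp_iff_of_deriv_ne_zero hg hg').1 (hφ.congr h1.symm), h1.eq_of_nhds⟩

/-! ### Principal square roots and the right half-plane. -/

namespace Complex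

theorem cpow_half_sq (w : ℂ) : (w ^ (1 / 2 : ℂ)) ^ 2 = w := by
  simp

theorem re_cpow_half_pos {w : ℂ} (hw : w ∈ slitPlane) : 0 < (w ^ (1 / 2 : ℂ)).re := by
  have h0 := slitPlane_ne_zero hw
  have h1 := slitPlane_arg_ne_pi hw
  have h2 := arg_le_pi w
  have h3 := neg_pi_lt_arg w
  have h4 : w.arg < Real.pi := lt_of_le_of_ne h2 h1
  rw [cpow_def_of_ne_zero h0, exp_re]
  refine mul_pos (Real.exp_pos _) (Real.cos_pos_of_mem_Ioo ?_)
  have : (log w * (1 / 2)).im = w.arg / 2 := by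
    rw [show (1 / 2 : ℂ) = ((1 / 2 : ℝ) : ℂ) by norm_num, im_mul_ofReal, log_im]; ring
  rw [this]
  constructor <;> linarith

theorem cpow_half_ne_zero {w : ℂ} (hw : w ∈ slitPlane) : w ^ (1 / 2 : ℂ) ≠ 0 := fun h => by
  have := re_cpow_half_pos hw
  simp [-one_div, h] at this

/-- Of the two square roots only the principal one has positive real part. This is how every branch
below is identified. -/
theorem eq_cpow_half {w v : ℂ} (hv : 0 < v.re) (h : v ^ 2 = w) : w ^ (1 / 2 : ℂ) = v := by
  have hw : w ∈ slitPlane := by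
    rw [← h, mem_slitPlane_iff, sq, mul_re, mul_im]
    by_cases hi : v.im = 0
    · left; rw [hi]; nlinarith
    · right; intro h0; apply hi
      have : v.re * v.im = 0 := by linarith
      exact (mul_eq_zero.1 this).resolve_left hv.ne'
  have h1 := re_cpow_half_pos hw
  rcases sq_eq_sq_iff_eq_or_eq_neg.1 ((cpow_half_sq w).trans h.symm) with h2 | h2
  · exact h2
  · rw [h2, neg_re] at h1; linarith

theorem one_add_sq_mem_slitPlane {t : ℂ} (ht : 0 < t.re) : 1 + t ^ 2 ∈ slitPlane := by
  rw [mem_slitPlane_iff, sq, add_re, add_im, mul_re, mul_im]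
  by_cases hi : t.im = 0
  · left; rw [hi]; simp; nlinarith
  · right; simp only [one_im]; intro h0; apply hi
    have : t.re * t.im = 0 := by linarith
    exact (mul_eq_zero.1 this).resolve_left ht.ne'

/-- Both sides have the same square, so only the branch matters. Since
$\operatorname{Im}q^2=\operatorname{Im}t^{-2}$ and $q,t$ lie in the right half-plane,
$\operatorname{Im}q$ and $\operatorname{Im}t$ have opposite signs (or vanish), which makes
$\operatorname{Re}(qt)>0$. -/
theorem cpow_half_one_add_inv_sq {t : ℂ} (ht : 0 < t.re) :
    (1 + t⁻¹ ^ 2) ^ (1 / 2 : ℂ) * t = (1 + t ^ 2) ^ (1 / 2 : ℂ) := by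
  have t0 : t ≠ 0 := by rintro rfl; simp at ht
  have ht' : 0 < t⁻¹.re := by
    rw [inv_re]; exact div_pos ht (normSq_pos.2 t0)
  set q := (1 + t⁻¹ ^ 2) ^ (1 / 2 : ℂ) with hq
  have hq2 : q ^ 2 = 1 + t⁻¹ ^ 2 := cpow_half_sq _
  have hqre : 0 < q.re := re_cpow_half_pos (one_add_sq_mem_slitPlane ht')
  have him : q.re * q.im * (t.re * t.im) ≤ 0 := by
    have h1 := congrArg im hq2
    rw [sq, sq, mul_im, add_im, mul_im, inv_re, inv_im, one_im] at h1
    have hn := normSq_pos.2 t0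
    have : q.re * q.im = -(t.re * t.im) / normSq t ^ 2 := by
      field_simp at h1 ⊢; linarith
    rw [this, div_mul_eq_mul_div]
    apply div_nonpos_of_nonpos_of_nonneg _ (by positivity)
    nlinarith [sq_nonneg (t.re * t.im)]
  have hqt : q.im * t.im ≤ 0 := by
    by_contra! hc
    have := mul_pos (mul_pos hqre ht) hc
    nlinarith
  symm
  apply eq_cpow_half
  · rw [mul_re]; have := mul_pos hqre ht; linarith
  · rw [mul_pow, hq2]; field_simp; ring

end Complex

/-! ### The identity $\mathrm{sn}^2+\mathrm{cn}^2=1$ at regular points. -/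

theorem jacobiSn_meromorphicNFAt (k z : ℂ) : MeromorphicNFAt (jacobiSn k) z :=
  ((isJacobiOn_jacobi k).nf z trivial).1

theorem jacobiCn_meromorphicNFAt (k z : ℂ) : MeromorphicNFAt (jacobiCn k) z :=
  ((isJacobiOn_jacobi k).nf z trivial).2.1

theorem eventually_jacobiSn_sq_add_jacobiCn_sq (k z : ℂ) :
    ∀ᶠ w in 𝓝[≠] z, jacobiSn k w ^ 2 + jacobiCn k w ^ 2 - 1 = 0 :=
  punctured_zero_of_zero (f := fun w => jacobiSn k w ^ 2 + jacobiCn k w ^ 2 - 1)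
    isPreconnected_univ trivial
    (fun z _ => (((jacobiSn_meromorphicNFAt k z).meromorphicAt.pow 2).add
      ((jacobiCn_meromorphicNFAt k z).meromorphicAt.pow 2)).sub (MeromorphicAt.const 1 z))
    (((isJacobiOn_jacobi k).invariant_zero trivial).mono fun _ hw => hw.1) trivial

/-- `cn` has no pole where `sn` has none. -/
theorem analyticAt_jacobiCn {k z : ℂ} (h : AnalyticAt ℂ (jacobiSn k) z) :
    AnalyticAt ℂ (jacobiCn k) z := by
  refine (meromorphicNFAt_iff_analyticAt_or.1 (jacobiCn_meromorphicNFAt k z)).resolve_right ?_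
  rintro ⟨-, ho, -⟩
  -- At a pole $|\mathrm{cn}|^2\to\infty$, but it equals $|1-\mathrm{sn}^2|$ nearby, which stays
  -- bounded.
  have h1 := (tendsto_norm_cobounded_atTop (E := ℂ)).comp
    (tendsto_cobounded_of_meromorphicOrderAt_neg ho)
  have h2 : Tendsto (fun w => ‖jacobiCn k w‖ ^ 2) (𝓝[≠] z) atTop :=
    (tendsto_pow_atTop two_ne_zero).comp h1
  have h3 : Tendsto (fun w => ‖1 - jacobiSn k w ^ 2‖) (𝓝[≠] z) (𝓝 ‖1 - jacobiSn k z ^ 2‖) :=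
    ((continuousAt_const.sub (h.continuousAt.pow 2)).norm.tendsto).mono_left nhdsWithin_le_nhds
  refine not_tendsto_atTop_of_tendsto_nhds h3 (h2.congr' ?_)
  filter_upwards [eventually_jacobiSn_sq_add_jacobiCn_sq k z] with w hw
  rw [← norm_pow]
  congr 1
  linear_combination hw

/-- Regularity of $\mathrm{sn}$ alone is assumed because that is all the elliptic integral yields at
$\gamma_o$. -/
theorem jacobiSn_sq_add_jacobiCn_sq {k z : ℂ} (h : AnalyticAt ℂ (jacobiSn k) z) :
    jacobiSn k z ^ 2 + jacobiCn k z ^ 2 = 1 := by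
  have hf : ContinuousAt (fun w => jacobiSn k w ^ 2 + jacobiCn k w ^ 2 - 1) z :=
    ((h.continuousAt.pow 2).add ((analyticAt_jacobiCn h).continuousAt.pow 2)).sub
      continuousAt_const
  have h1 := tendsto_nhds_unique (hf.tendsto.mono_left nhdsWithin_le_nhds)
    (tendsto_const_nhds.congr' ((eventually_jacobiSn_sq_add_jacobiCn_sq k z).mono
      fun _ hw => hw.symm))
  exact sub_eq_zero.1 h1

/-! ### The elliptic integral that inverts $\mathrm{sn}$ in the imaginary direction. -/

/-- A star-shaped domain of the integrand `((1 + t ^ 2) (1 + k ^ 2 t ^ 2)) ^ (-1 / 2)` of the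
elliptic integral that inverts `t = -i sn(i v)`. -/
def imagIntegrandDomain (k : ℂ) : Set ℂ :=
  {t | 1 + t ^ 2 ∈ Complex.slitPlane ∧ 1 + (k * t) ^ 2 ∈ Complex.slitPlane}

/-- The integrand `((1 + t ^ 2) (1 + k ^ 2 t ^ 2)) ^ (-1 / 2)`. -/
noncomputable def imagIntegrand (k t : ℂ) : ℂ :=
  ((1 + t ^ 2) ^ (1 / 2 : ℂ) * (1 + (k * t) ^ 2) ^ (1 / 2 : ℂ))⁻¹

theorem isOpen_imagIntegrandDomain (k : ℂ) : IsOpen (imagIntegrandDomain k) :=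
  (Complex.isOpen_slitPlane.preimage (by fun_prop)).inter
    (Complex.isOpen_slitPlane.preimage (by fun_prop))

theorem zero_mem_imagIntegrandDomain (k : ℂ) : (0 : ℂ) ∈ imagIntegrandDomain k := by
  simp [imagIntegrandDomain]

theorem starConvex_imagIntegrandDomain (k : ℂ) : StarConvex ℝ 0 (imagIntegrandDomain k) := by
  -- Scaling $t$ by $b$ scales $t^2$ by $b^2\in[0,1]$, so the point moves along the segment from
  -- $1+x$ to $1$, about which the slit plane is star-shaped.
  have key : ∀ {x : ℂ} {b : ℝ}, 0 ≤ b → b ≤ 1 → 1 + x ∈ Complex.slitPlane →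
      1 + (b : ℂ) ^ 2 * x ∈ Complex.slitPlane := by
    intro x b hb hb1 hx
    have := Complex.starConvex_one_slitPlane.add_smul_mem hx (sq_nonneg b) (pow_le_one₀ hb hb1)
    simpa using this
  rw [starConvex_zero_iff]
  rintro x ⟨h1, h2⟩ b hb hb1
  refine ⟨?_, ?_⟩
  · convert key hb hb1 h1 using 1
    simp [mul_pow]
  · convert key hb hb1 h2 using 1
    simp [mul_pow]; ring

theorem differentiableOn_imagIntegrand (k : ℂ) :
    DifferentiableOn ℂ (imagIntegrand k) (imagIntegrandDomain k) := by
  rintro t ⟨h1, h2⟩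
  have e1 : DifferentiableAt ℂ (fun t : ℂ => (1 + t ^ 2) ^ (1 / 2 : ℂ)) t :=
    DifferentiableAt.cpow (by fun_prop) (by fun_prop) h1
  have e2 : DifferentiableAt ℂ (fun t : ℂ => (1 + (k * t) ^ 2) ^ (1 / 2 : ℂ)) t :=
    DifferentiableAt.cpow (by fun_prop) (by fun_prop) h2
  exact ((e1.mul e2).inv (mul_ne_zero (Complex.cpow_half_ne_zero h1)
    (Complex.cpow_half_ne_zero h2))).differentiableWithinAt

theorem imagIntegrand_ne_zero {k t : ℂ} (ht : t ∈ imagIntegrandDomain k) :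
    imagIntegrand k t ≠ 0 :=
  inv_ne_zero (mul_ne_zero (Complex.cpow_half_ne_zero ht.1) (Complex.cpow_half_ne_zero ht.2))

/-- `V` is the primitive of the integrand that vanishes at the origin. -/
structure IsImagIntegral (k : ℂ) (V : ℂ → ℂ) : Prop where
  map_zero : V 0 = 0
  hasDerivAt : ∀ t ∈ imagIntegrandDomain k, HasDerivAt V (imagIntegrand k t) t

theorem exists_isImagIntegral (k : ℂ) : ∃ V, IsImagIntegral k V := by
  obtain ⟨V, h0, hV⟩ := exists_primitive_of_starConvex (isOpen_imagIntegrandDomain k)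
    (starConvex_imagIntegrandDomain k) (differentiableOn_imagIntegrand k)
  exact ⟨V, h0, hV⟩

theorem IsImagIntegral.analyticAt {k : ℂ} {V : ℂ → ℂ} (hV : IsImagIntegral k V) {t : ℂ}
    (ht : t ∈ imagIntegrandDomain k) : AnalyticAt ℂ V t :=
  DifferentiableOn.analyticAt
    (fun x hx => (hV.hasDerivAt x hx).differentiableAt.differentiableWithinAt)
    ((isOpen_imagIntegrandDomain k).mem_nhds ht)

/-- A function with nonzero derivative separates two curves through the same point. -/
theorem eventuallyEq_of_comp_eventuallyEq {V x y : ℂ → ℂ} {V' a b : ℂ}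
    (hV : HasStrictDerivAt V V' b)
    (hV' : V' ≠ 0) (hx : Tendsto x (𝓝 a) (𝓝 b)) (hy : Tendsto y (𝓝 a) (𝓝 b))
    (h : ∀ᶠ t in 𝓝 a, V (x t) = V (y t)) : x =ᶠ[𝓝 a] y := by
  have h1 := (hV.hasStrictFDerivAt_equiv hV').eventually_left_inverse
  filter_upwards [hx.eventually h1, hy.eventually h1, h] with t h2 h3 h4
  rw [← h2, h4, h3]

/-- By the chain rule $V(-\mathrm i\,\mathrm{sn}(\mathrm iV(t)))-V(t)$ has derivative $0$ near $0$
and vanishes at $0$; local injectivity of $V$ then cancels the outer $V$. -/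
theorem IsImagIntegral.jacobiSn_germ {k : ℂ} {V : ℂ → ℂ} (hV : IsImagIntegral k V) :
    ∀ᶠ t in 𝓝 0, jacobiSn k (Complex.I * V t) = Complex.I * t := by
  have hJ := isJacobiOn_jacobi k
  have hD := zero_mem_imagIntegrandDomain k
  have hDn := (isOpen_imagIntegrandDomain k).mem_nhds hD
  have hg : Tendsto (fun t => Complex.I * V t) (𝓝 0) (𝓝 0) := by
    have := (hV.analyticAt hD).continuousAt.tendsto.const_mul Complex.I
    rwa [hV.map_zero, mul_zero] at this
  have hx : Tendsto (fun t => -Complex.I * jacobiSn k (Complex.I * V t)) (𝓝 0) (𝓝 0) := by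
    have h1 : Tendsto (jacobiSn k) (𝓝 0) (𝓝 0) := by
      simpa [ContinuousAt, hJ.init.1] using hJ.an.1.continuousAt
    simpa using (h1.comp hg).const_mul (-Complex.I)
  have re_pos : ∀ {f : ℂ → ℂ}, AnalyticAt ℂ f 0 → f 0 = 1 → ∀ᶠ w in 𝓝 0, 0 < (f w).re := by
    intro f hf h0
    have h1 := Complex.continuous_re.continuousAt.comp hf.continuousAt
    exact h1.eventually_const_lt (by simp [h0])
  have loc : ∀ᶠ t in 𝓝 (0 : ℂ),
      HasDerivAt (fun t => V (-Complex.I * jacobiSn k (Complex.I * V t)) - V t) 0 t := by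
    filter_upwards [hDn, hx.eventually hDn, hg.eventually (hJ.ode_nhds_zero trivial),
      hg.eventually (hJ.invariant_zero trivial), hg.eventually (re_pos hJ.an.2.1 hJ.init.2.1),
      hg.eventually (re_pos hJ.an.2.2 hJ.init.2.2)] with t h1 h2 h3 h4 h5 h6
    have dV := hV.hasDerivAt t h1
    have d2 := (h3.1.comp t (dV.const_mul Complex.I)).const_mul (-Complex.I)
    refine (((hV.hasDerivAt _ h2).comp t d2).sub dV).congr_deriv ?_
    set S := jacobiSn k (Complex.I * V t)
    set C := jacobiCn k (Complex.I * V t)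
    set Δ := jacobiDn k (Complex.I * V t)
    -- Near the origin $\mathrm{cn}$ and $\mathrm{dn}$ are close to $1$, so they are the principal
    -- roots of $1-\mathrm{sn}^2$ and $1-k^2\mathrm{sn}^2$.
    have e : imagIntegrand k (-Complex.I * S) = (C * Δ)⁻¹ := by
      rw [imagIntegrand, Complex.eq_cpow_half h5 (w := 1 + (-Complex.I * S) ^ 2),
        Complex.eq_cpow_half h6 (w := 1 + (k * (-Complex.I * S)) ^ 2)]
      · linear_combination h4.2 - k ^ 2 * S ^ 2 * Complex.I_sq
      · linear_combination h4.1 - S ^ 2 * Complex.I_sq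
    have hC : C ≠ 0 := by intro h; rw [h] at h5; simp at h5
    have hΔ : Δ ≠ 0 := by intro h; rw [h] at h6; simp at h6
    rw [e]
    field_simp
    linear_combination -imagIntegrand k t * Complex.I_sq
  obtain ⟨r, hr, hb⟩ := Metric.eventually_nhds_iff_ball.1 loc
  have hcomp : ∀ᶠ t in 𝓝 (0 : ℂ), V (-Complex.I * jacobiSn k (Complex.I * V t)) = V (id t) := by
    filter_upwards [Metric.ball_mem_nhds (0 : ℂ) hr] with t ht
    have := Metric.isOpen_ball.is_const_of_deriv_eq_zero (convex_ball _ _).isPreconnected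
      (fun x hx => (hb x hx).differentiableAt.differentiableWithinAt)
      (fun x hx => (hb x hx).deriv) ht (Metric.mem_ball_self hr)
    simpa [hV.map_zero, hJ.init.1, sub_eq_zero] using this
  have hs : HasStrictDerivAt V (imagIntegrand k 0) 0 := by
    have := (hV.analyticAt hD).hasStrictDerivAt
    rwa [(hV.hasDerivAt 0 hD).deriv] at this
  filter_upwards [eventuallyEq_of_comp_eventuallyEq hs (imagIntegrand_ne_zero hD) hx tendsto_id
    hcomp] with t ht
  simp only [id] at ht
  linear_combination Complex.I * ht + jacobiSn k (Complex.I * V t) * Complex.I_sq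

/-- The germ at $0$ spreads over the connected domain as a meromorphic identity. As $V'\ne0$,
$\mathrm iV$ is a local coordinate, so analyticity of $\mathrm it$ excludes a pole of $\mathrm{sn}$.
-/
theorem IsImagIntegral.jacobiSn_eq {k : ℂ} {V : ℂ → ℂ} (hV : IsImagIntegral k V) {t : ℂ}
    (ht : t ∈ imagIntegrandDomain k) :
    AnalyticAt ℂ (jacobiSn k) (Complex.I * V t) ∧
      jacobiSn k (Complex.I * V t) = Complex.I * t := by
  have hg : ∀ x ∈ imagIntegrandDomain k, AnalyticAt ℂ (fun t => Complex.I * V t) x :=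
    fun x hx => analyticAt_const.mul (hV.analyticAt hx)
  have hid := punctured_zero_of_zero
    (f := fun t => jacobiSn k (Complex.I * V t) - Complex.I * t)
    ((starConvex_imagIntegrandDomain k).isPathConnected
      (zero_mem_imagIntegrandDomain k)).isConnected.isPreconnected
    (zero_mem_imagIntegrandDomain k)
    (fun x hx => ((jacobiSn_meromorphicNFAt k _).meromorphicAt.comp_analyticAt (hg x hx)).sub
      (AnalyticAt.meromorphicAt (by fun_prop)))
    (hV.jacobiSn_germ.mono fun t ht => sub_eq_zero.2 ht) ht
  refine (jacobiSn_meromorphicNFAt k _).analyticAt_and_eq_of_comp (hg t ht) ?_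
    (φ := fun t => Complex.I * t) (by fun_prop) (hid.mono fun w hw => sub_eq_zero.1 hw)
  rw [((hV.hasDerivAt t ht).const_mul Complex.I).deriv]
  exact mul_ne_zero Complex.I_ne_zero (imagIntegrand_ne_zero ht)

/-! ### The involution $t\mapsto1/(kt)$. -/

/-- The cone `Re t > 0`, `Re (k t) > 0`, which the involution `t ↦ 1 / (k t)` preserves. -/
def imagCone (k : ℂ) : Set ℂ := {t | 0 < t.re ∧ 0 < (k * t).re}

theorem imagCone_subset (k : ℂ) : imagCone k ⊆ imagIntegrandDomain k := fun _ ht =>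
  ⟨Complex.one_add_sq_mem_slitPlane ht.1, Complex.one_add_sq_mem_slitPlane ht.2⟩

theorem isOpen_imagCone (k : ℂ) : IsOpen (imagCone k) :=
  (isOpen_lt continuous_const Complex.continuous_re).inter
    (isOpen_lt continuous_const (Complex.continuous_re.comp (continuous_const_mul k)))

theorem convex_imagCone (k : ℂ) : Convex ℝ (imagCone k) := by
  rintro x ⟨hx, hx'⟩ y ⟨hy, hy'⟩ a b ha hb hab
  have key : ∀ p q : ℝ, 0 < p → 0 < q → 0 < a * p + b * q := fun p q hp hq => by
    rcases ha.eq_or_lt with rfl | ha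
    · have : b = 1 := by linarith
      simpa [this]
    · positivity
  refine ⟨?_, ?_⟩
  · simpa using key _ _ hx hy
  · have e : (k * (a • x + b • y)).re = a * (k * x).re + b * (k * y).re := by
      simp; ring
    rw [e]
    exact key _ _ hx' hy'

theorem Complex.inv_re_pos {t : ℂ} (ht : 0 < t.re) : 0 < t⁻¹.re := by
  have t0 : t ≠ 0 := by rintro rfl; simp at ht
  rw [inv_re]
  exact div_pos ht (normSq_pos.2 t0)

theorem inv_mem_imagCone {k t : ℂ} (hk : k ≠ 0) (ht : t ∈ imagCone k) :
    (k * t)⁻¹ ∈ imagCone k := by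
  refine ⟨Complex.inv_re_pos ht.2, ?_⟩
  rw [mul_inv, mul_inv_cancel_left₀ hk]
  exact Complex.inv_re_pos ht.1

/-- On the cone the factors $t$ and $kt$ can be pulled out of the two roots without a change of
branch. The factor $kt^2$ cancels against the derivative $-1/(kt^2)$ of the involution. -/
theorem imagIntegrand_inv {k t : ℂ} (hk : k ≠ 0) (ht : t ∈ imagCone k) :
    imagIntegrand k (k * t)⁻¹ = k * t ^ 2 * imagIntegrand k t := by
  have t0 : t ≠ 0 := by rintro rfl; simpa using ht.1
  have h1 := Complex.cpow_half_one_add_inv_sq ht.1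
  have h2 := Complex.cpow_half_one_add_inv_sq ht.2
  have n1 := Complex.cpow_half_ne_zero (Complex.one_add_sq_mem_slitPlane (Complex.inv_re_pos ht.1))
  have n2 := Complex.cpow_half_ne_zero (Complex.one_add_sq_mem_slitPlane (Complex.inv_re_pos ht.2))
  rw [imagIntegrand, imagIntegrand, ← h1, ← h2, show k * (k * t)⁻¹ = t⁻¹ by field_simp]
  generalize (1 + t⁻¹ ^ 2) ^ (1 / 2 : ℂ) = p at *
  generalize (1 + (k * t)⁻¹ ^ 2) ^ (1 / 2 : ℂ) = q at *
  field_simp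

theorem IsImagIntegral.add_inv_eq {k : ℂ} {V : ℂ → ℂ} (hV : IsImagIntegral k V) (hk : k ≠ 0)
    {t u : ℂ} (ht : t ∈ imagCone k) (hu : u ∈ imagCone k) :
    V t + V (k * t)⁻¹ = V u + V (k * u)⁻¹ := by
  have hd : ∀ x ∈ imagCone k, HasDerivAt (fun x => V x + V (k * x)⁻¹) 0 x := by
    intro x hx
    have x0 : x ≠ 0 := by rintro rfl; simpa using hx.1
    have d1 : HasDerivAt (fun x => (k * x)⁻¹) (-(k * 1) / (k * x) ^ 2) x :=
      ((hasDerivAt_id x).const_mul k).inv (mul_ne_zero hk x0)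
    refine ((hV.hasDerivAt x (imagCone_subset k hx)).add
      ((hV.hasDerivAt _ (imagCone_subset k (inv_mem_imagCone hk hx))).comp x d1)).congr_deriv ?_
    rw [imagIntegrand_inv hk hx]
    field_simp
    ring
  exact (isOpen_imagCone k).is_const_of_deriv_eq_zero (convex_imagCone k).isPreconnected
    (fun x hx => (hd x hx).differentiableAt.differentiableWithinAt)
    (fun x hx => (hd x hx).deriv) ht hu

/-! ### $K'$ as the limit of $V$ at $+\infty$, and the value of $\mathrm{sn}$ at $\mathrm iK'/2$. -/

/-- The imaginary part is $2\operatorname{Re}k\operatorname{Im}k\,b^2$; it vanishes only for real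
$k$ or $b=0$, and then the sum is positive. This keeps the path of integration off the branch cuts.
-/
theorem sq_add_mul_sq_mem_slitPlane {k : ℂ} (hk : 0 < k.re) {a b : ℝ} (h : a ≠ 0 ∨ b ≠ 0) :
    (a : ℂ) ^ 2 + (k * b) ^ 2 ∈ Complex.slitPlane := by
  have e1 : ((a : ℂ) ^ 2 + (k * b) ^ 2).re = a ^ 2 + (k.re ^ 2 - k.im ^ 2) * b ^ 2 := by
    simp [sq]; ring
  have e2 : ((a : ℂ) ^ 2 + (k * b) ^ 2).im = 2 * k.re * (k.im * b ^ 2) := by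
    simp [sq]; ring
  rw [Complex.mem_slitPlane_iff, e1, e2]
  by_cases h0 : k.im * b ^ 2 = 0
  · left
    rcases mul_eq_zero.1 h0 with h1 | h1
    · rw [h1]
      rcases h with h | h
      · have := sq_pos_of_ne_zero h
        nlinarith [mul_nonneg (sq_nonneg k.re) (sq_nonneg b)]
      · have := mul_pos (sq_pos_of_pos hk) (sq_pos_of_ne_zero h)
        nlinarith [sq_nonneg a]
    · have hb : b = 0 := pow_eq_zero_iff two_ne_zero |>.1 h1
      have := sq_pos_of_ne_zero (h.resolve_right (not_not.2 hb))
      rw [h1]; linarith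
  · right
    exact mul_ne_zero (mul_pos two_pos hk).ne' h0

theorem ofReal_mem_imagIntegrandDomain {k : ℂ} (hk : 0 < k.re) (t : ℝ) :
    (t : ℂ) ∈ imagIntegrandDomain k := by
  have h1 := sq_add_mul_sq_mem_slitPlane (k := 1) (by simp) (a := 1) (b := t) (by simp)
  have h2 := sq_add_mul_sq_mem_slitPlane hk (a := 1) (b := t) (by simp)
  simp only [Complex.ofReal_one, one_pow, one_mul] at h1 h2
  exact ⟨h1, h2⟩

/-- The integrand of `K'`. -/
noncomputable def compIntegrand (k : ℂ) (θ : ℝ) : ℂ :=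
  1 / ((Real.cos θ : ℂ) ^ 2 + (k * Real.sin θ) ^ 2) ^ (1 / 2 : ℂ)

/-- Only the square of the complementary modulus enters, and
$1-(1-k^2)\sin^2\theta=\cos^2\theta+k^2\sin^2\theta$. -/
theorem completeEllipticK'_eq (k : ℂ) :
    completeEllipticK' k = ∫ θ in (0 : ℝ)..(Real.pi / 2), compIntegrand k θ := by
  rw [completeEllipticK', completeEllipticK]
  refine intervalIntegral.integral_congr fun θ _ => ?_
  have h : (Real.cos θ : ℂ) ^ 2 = 1 - (Real.sin θ : ℂ) ^ 2 := by
    rw [eq_sub_iff_add_eq]; exact_mod_cast Real.cos_sq_add_sin_sq θ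
  simp only [compIntegrand]
  rw [Complex.cpow_half_sq, h]
  congr 2
  ring

theorem continuous_compIntegrand {k : ℂ} (hk : 0 < k.re) : Continuous (compIntegrand k) := by
  have mem : ∀ θ : ℝ, (Real.cos θ : ℂ) ^ 2 + (k * Real.sin θ) ^ 2 ∈ Complex.slitPlane := by
    intro θ
    refine sq_add_mul_sq_mem_slitPlane hk ?_
    by_contra! h
    have := Real.cos_sq_add_sin_sq θ
    simp [h.1, h.2] at this
  refine continuous_const.div (Continuous.cpow (by fun_prop) continuous_const mem) fun θ =>
    Complex.cpow_half_ne_zero (mem θ)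

theorem IsImagIntegral.hasDerivAt_comp_tan {k : ℂ} {V : ℂ → ℂ} (hV : IsImagIntegral k V)
    (hk : 0 < k.re) {θ : ℝ} (hθ : 0 < Real.cos θ) :
    HasDerivAt (fun θ : ℝ => V (Real.tan θ)) (compIntegrand k θ) θ := by
  have hmem := ofReal_mem_imagIntegrandDomain hk (Real.tan θ)
  refine ((hV.hasDerivAt _ hmem).comp θ (Real.hasDerivAt_tan hθ.ne').ofReal_comp).congr_deriv ?_
  have c0 : (Real.cos θ : ℂ) ≠ 0 := by exact_mod_cast hθ.ne'
  have hcs : (Real.cos θ : ℂ) ^ 2 + (Real.sin θ : ℂ) ^ 2 = 1 := by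
    exact_mod_cast Real.cos_sq_add_sin_sq θ
  have ht : ((Real.tan θ : ℝ) : ℂ) = Real.sin θ / Real.cos θ := by
    rw [Real.tan_eq_sin_div_cos]; push_cast; rfl
  have q0 := Complex.cpow_half_ne_zero hmem.2
  have e1 : (1 + ((Real.tan θ : ℝ) : ℂ) ^ 2) ^ (1 / 2 : ℂ) = (((Real.cos θ)⁻¹ : ℝ) : ℂ) := by
    apply Complex.eq_cpow_half
    · rw [Complex.ofReal_re]; exact inv_pos.2 hθ
    · rw [ht, Complex.ofReal_inv]
      field_simp
      exact hcs.symm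
  -- Multiplication by $\cos\theta>0$ preserves the right half-plane, hence the branch.
  have e2 : ((Real.cos θ : ℂ) ^ 2 + (k * Real.sin θ) ^ 2) ^ (1 / 2 : ℂ)
      = Real.cos θ * (1 + (k * (Real.tan θ : ℝ)) ^ 2) ^ (1 / 2 : ℂ) := by
    apply Complex.eq_cpow_half
    · rw [Complex.re_ofReal_mul]
      exact mul_pos hθ (Complex.re_cpow_half_pos hmem.2)
    · rw [mul_pow, Complex.cpow_half_sq, ht]; field_simp
  rw [compIntegrand, imagIntegrand, e1, e2]
  generalize (1 + (k * ((Real.tan θ : ℝ) : ℂ)) ^ 2) ^ (1 / 2 : ℂ) = q at *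
  push_cast at *
  field_simp

theorem IsImagIntegral.tendsto_tan {k : ℂ} {V : ℂ → ℂ} (hV : IsImagIntegral k V)
    (hk : 0 < k.re) :
    Tendsto (fun θ : ℝ => V (Real.tan θ)) (𝓝[<] (Real.pi / 2)) (𝓝 (completeEllipticK' k)) := by
  have hc := continuous_compIntegrand hk
  rw [completeEllipticK'_eq]
  have h1 : Tendsto (fun θ => ∫ x in (0 : ℝ)..θ, compIntegrand k x) (𝓝[<] (Real.pi / 2))
      (𝓝 (∫ x in (0 : ℝ)..(Real.pi / 2), compIntegrand k x)) :=
    ((intervalIntegral.continuous_primitive (fun a b => hc.intervalIntegrable a b) 0).tendsto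
      _).mono_left nhdsWithin_le_nhds
  refine h1.congr' ?_
  filter_upwards [Ioo_mem_nhdsLT (show (0 : ℝ) < Real.pi / 2 by positivity)] with θ hθ
  rw [intervalIntegral.integral_eq_sub_of_hasDerivAt (f := fun θ : ℝ => V (Real.tan θ))
    (fun x hx => hV.hasDerivAt_comp_tan hk ?_) (hc.intervalIntegrable _ _)]
  · simp [hV.map_zero]
  · rw [Set.uIcc_of_le hθ.1.le] at hx
    have := hθ.2
    have := Real.pi_pos
    exact Real.cos_pos_of_mem_Ioo ⟨by linarith [hx.1], by linarith [hx.2]⟩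

/-- The sum is constant on the cone, which contains the positive reals. Along $t=\tan\theta$,
$\theta\to\pi/2$, the first term tends to $K'$ and the second to $V(0)=0$. -/
theorem IsImagIntegral.add_inv_eq_completeEllipticK' {k : ℂ} {V : ℂ → ℂ}
    (hV : IsImagIntegral k V) (hk : 0 < k.re) {t : ℂ} (ht : t ∈ imagCone k) :
    V t + V (k * t)⁻¹ = completeEllipticK' k := by
  have k0 : k ≠ 0 := by rintro rfl; simp at hk
  have h1 : Tendsto (fun θ : ℝ => (k * (Real.tan θ : ℝ))⁻¹) (𝓝[<] (Real.pi / 2)) (𝓝 (0 : ℂ)) := by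
    have e := (Complex.continuous_ofReal.tendsto 0).comp
      (tendsto_inv_atTop_zero.comp Real.tendsto_tan_pi_div_two)
    have := e.const_mul k⁻¹
    rw [Complex.ofReal_zero, mul_zero] at this
    refine this.congr fun θ => ?_
    rw [mul_inv, ← Complex.ofReal_inv]
    rfl
  have h2 : Tendsto V (𝓝 0) (𝓝 0) := by
    have := (hV.analyticAt (zero_mem_imagIntegrandDomain k)).continuousAt.tendsto
    rwa [hV.map_zero] at this
  have h3 := (hV.tendsto_tan hk).add (h2.comp h1)
  rw [add_zero] at h3
  refine tendsto_nhds_unique (tendsto_const_nhds.congr' ?_) h3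
  filter_upwards [Real.tendsto_tan_pi_div_two.eventually_gt_atTop 0] with θ hθ
  exact hV.add_inv_eq k0 ht ⟨by rwa [Complex.ofReal_re], by
    rw [Complex.re_mul_ofReal]; exact mul_pos hk hθ⟩

/-- `sn` at the quarter period: `sn(i K' / 2) ^ 2 = -1 / k`, without a pole there. -/
theorem jacobiSn_half_completeEllipticK' {k : ℂ} (hk : 0 < k.re) :
    AnalyticAt ℂ (jacobiSn k) (Complex.I * completeEllipticK' k / 2) ∧
      k * jacobiSn k (Complex.I * completeEllipticK' k / 2) ^ 2 = -1 := by
  have k0 : k ≠ 0 := by rintro rfl; simp at hk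
  obtain ⟨V, hV⟩ := exists_isImagIntegral k
  set r := k ^ (1 / 2 : ℂ) with hr
  have hr2 : r ^ 2 = k := Complex.cpow_half_sq k
  have hrpos : 0 < r.re := Complex.re_cpow_half_pos (Or.inl hk)
  have r0 : r ≠ 0 := by intro h; rw [h] at hrpos; simp at hrpos
  have hkr : k * r⁻¹ = r := by rw [← hr2]; field_simp
  -- $r^{-1}=k^{-1/2}$ is the fixed point of the involution in the cone, so the sum there is
  -- $2V(r^{-1})$.
  have hmem : r⁻¹ ∈ imagCone k := ⟨Complex.inv_re_pos hrpos, by rwa [hkr]⟩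
  have h1 := hV.add_inv_eq_completeEllipticK' hk hmem
  rw [hkr] at h1
  have h2 : Complex.I * completeEllipticK' k / 2 = Complex.I * V r⁻¹ := by rw [← h1]; ring
  obtain ⟨h3, h4⟩ := hV.jacobiSn_eq (imagCone_subset k hmem)
  rw [h2]
  refine ⟨h3, ?_⟩
  rw [h4, ← hr2, mul_pow, Complex.I_sq]
  field_simp

/-! ### Algebra of the common relation. -/

/-- The $XY$ terms cancel for $Y'=-Y$; the rest matches because $k^2X^2Y^2=1$ and $X^2=Y^2$. -/
theorem rcgRelation_of_sq_eq {k γ z X Y : ℂ} (hXY : X ^ 2 = Y ^ 2) (hY : k * Y ^ 2 = 1) :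
    RCGRelation k γ z X Y (-Y) := by
  rw [RCGRelation]
  linear_combination
    (-(k * (k * Y ^ 2) * (jacobiCn k γ ^ 2 - jacobiCn k z ^ 2) * jacobiCn k z * jacobiDn k z)
      + (1 - k ^ 2 * jacobiSn k γ ^ 2 * jacobiSn k z ^ 2) * jacobiCn k z * jacobiDn k z) * hXY
    - (jacobiCn k γ ^ 2 - jacobiCn k z ^ 2) * jacobiCn k z * jacobiDn k z * (k * Y ^ 2 + 1) * hY

/-- For $Y'=-Y$ and $kY^2=1$ the relation reduces to $(kP-S)(1-kX^2)\,\mathrm{cn}z\,\mathrm{dn}z=0$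
up to a power of $k$, and $k\,\mathrm{sn}^2\gamma=-1$ makes $kP=S=1+k\,\mathrm{sn}^2z$. -/
theorem rcgRelation_of_sn_sq {k γ z X Y : ℂ} (hγ : jacobiSn k γ ^ 2 + jacobiCn k γ ^ 2 = 1)
    (hz : jacobiSn k z ^ 2 + jacobiCn k z ^ 2 = 1) (hsn : k * jacobiSn k γ ^ 2 = -1)
    (hY : k * Y ^ 2 = 1) : RCGRelation k γ z X Y (-Y) := by
  have hP : jacobiCn k γ ^ 2 - jacobiCn k z ^ 2 = jacobiSn k z ^ 2 - jacobiSn k γ ^ 2 := by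
    linear_combination hγ - hz
  rw [RCGRelation, hP]
  linear_combination
    jacobiCn k z * jacobiDn k z * ((1 - k * jacobiSn k z ^ 2) * (X ^ 2 - Y ^ 2) * hsn
      - (k * X ^ 2 + 1) * (jacobiSn k z ^ 2 - jacobiSn k γ ^ 2) * hY)

/-- With $kX^2=1$ the coefficients combine to
$kP+S=(1-k\,\mathrm{sn}^2\gamma)(1+k\,\mathrm{sn}^2z)$, which shares the factor
$1+k\,\mathrm{sn}^2z$ with $1-k^2\mathrm{sn}^4z$. The relation is the bilinear equation times this
factor. -/
theorem rcgRelation_of_bilinear {k γ z X Y Y' : ℂ}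
    (hγ : jacobiSn k γ ^ 2 + jacobiCn k γ ^ 2 = 1)
    (hz : jacobiSn k z ^ 2 + jacobiCn k z ^ 2 = 1) (hX : k * X ^ 2 = 1)
    (h : (1 - k * jacobiSn k γ ^ 2) * (jacobiCn k z * jacobiDn k z) * (Y * Y' + X ^ 2)
      = (1 - k * jacobiSn k z ^ 2) * (jacobiCn k γ * jacobiDn k γ) * X * (Y + Y')) :
    RCGRelation k γ z X Y Y' := by
  have hP : jacobiCn k γ ^ 2 - jacobiCn k z ^ 2 = jacobiSn k z ^ 2 - jacobiSn k γ ^ 2 := by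
    linear_combination hγ - hz
  rw [RCGRelation, hP]
  linear_combination (1 + k * jacobiSn k z ^ 2) * h
    + jacobiCn k z * jacobiDn k z * (jacobiSn k z ^ 2 - jacobiSn k γ ^ 2) * (k * Y * Y' - 1) * hX

/-! ### Tangents, signs and the solutions. -/

/-- The addition formula with denominators cleared, so that no division by $1-\tan u\tan v$ occurs.
-/
theorem Complex.tan_add_tan_eq {u v a : ℂ} (hu : cos u ≠ 0) (hv : cos v ≠ 0)
    (h : sin (u + v) = a * cos (u + v)) : tan u + tan v = a * (1 - tan u * tan v) := by
  rw [sin_add, cos_add] at h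
  rw [tan_eq_sin_div_cos, tan_eq_sin_div_cos]
  field_simp
  linear_combination h

theorem IsArctanValue.sin_eq {a w : ℂ} (h : IsArctanValue a w) :
    Complex.sin w = a * Complex.cos w := by
  rw [← h.2, Complex.tan_mul_cos h.1]

theorem neg_one_zpow_eq_or (n : ℤ) : (-1 : ℂ) ^ n = 1 ∨ (-1 : ℂ) ^ n = -1 :=
  (Int.even_or_odd n).imp Even.neg_one_zpow Odd.neg_one_zpow

theorem neg_one_zpow_sq (n : ℤ) : ((-1 : ℂ) ^ n) ^ 2 = 1 := by
  rcases neg_one_zpow_eq_or n with h | h <;> simp [h]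

theorem neg_one_zpow_add_one (n : ℤ) : (-1 : ℂ) ^ (n + 1) = -(-1) ^ n := by
  rw [zpow_add_one₀ (by norm_num)]; ring

theorem isRCGSolution_alternating {k γe γo z0 : ℂ} {x y : ℤ → ℂ} (hk : k ≠ 0)
    (hx : ∀ n, x (n + 1) = -x n) (hy : ∀ n, y (n + 1) = -y n) (hx2 : ∀ n, k * x n ^ 2 = 1)
    (hy2 : ∀ n, k * y n ^ 2 = 1) : IsRCGSolution k γe γo z0 x y := by
  have e : ∀ n m, x n ^ 2 = y m ^ 2 := fun n m =>
    mul_left_cancel₀ hk ((hx2 n).trans (hy2 m).symm)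
  intro n
  constructor
  · rw [hy]; exact rcgRelation_of_sq_eq (e n n) (hy2 n)
  · rw [hx]; exact rcgRelation_of_sq_eq (e n (n + 1)).symm (hx2 n)

/-- The family through the linear equation; `c = ±1 / k ^ (1 / 2)` covers both signs. -/
theorem isRCGSolution_tan {k c γe γo z0 : ℂ} (hc : k * c ^ 2 = 1)
    (hγe : JacobiRegularAt k γe) (hγo : AnalyticAt ℂ (jacobiSn k) γo)
    (hsn : k * jacobiSn k γo ^ 2 = -1)
    (hz : ∀ n : ℤ, JacobiRegularAt k (rcgZ γe γo z0 n))
    (hzhat : ∀ n : ℤ, JacobiRegularAt k (rcgZ γe γo z0 n + γe + γo))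
    (hcn : jacobiCn k γe ≠ 0) (hdn : jacobiDn k γe ≠ 0)
    (h1 : ∀ n : ℤ, 1 - k * jacobiSn k (rcgZ γe γo z0 n) ^ 2 ≠ 0) {u w : ℤ → ℂ}
    (hu : ∀ n : ℤ, Complex.cos (u n) ≠ 0)
    (hw : ∀ n : ℤ, IsArctanValue (rcgA k γe γo z0 n) (w n))
    (huw : ∀ n : ℤ, u (n + 1) + u n = (-1) ^ n * w n) :
    IsRCGSolution k γe γo z0 (fun n => (-1) ^ n * c)
      (fun n => Complex.I * Complex.tan (u n) * c) := by
  have hx2 : ∀ n : ℤ, k * ((-1) ^ n * c) ^ 2 = 1 := fun n => by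
    rw [mul_pow, neg_one_zpow_sq, one_mul, hc]
  intro n
  constructor
  · refine rcgRelation_of_bilinear (jacobiSn_sq_add_jacobiCn_sq hγe.1)
      (jacobiSn_sq_add_jacobiCn_sq (hz n).1) (hx2 n) ?_
    have hA : rcgA k γe γo z0 n * (jacobiCn k γe * jacobiDn k γe
        * (1 - k * jacobiSn k (rcgZ γe γo z0 n) ^ 2)) = -Complex.I * ((1 - k * jacobiSn k γe ^ 2)
        * jacobiCn k (rcgZ γe γo z0 n) * jacobiDn k (rcgZ γe γo z0 n)) :=
      div_mul_cancel₀ _ (mul_ne_zero (mul_ne_zero hcn hdn) (h1 n))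
    have ht : Complex.tan (u (n + 1)) + Complex.tan (u n) = (-1) ^ n * rcgA k γe γo z0 n
        * (1 - Complex.tan (u (n + 1)) * Complex.tan (u n)) := by
      refine Complex.tan_add_tan_eq (hu _) (hu _) ?_
      rw [huw]
      -- The sign passes through because sine is odd and cosine even.
      rcases neg_one_zpow_eq_or n with h | h <;> simp [h, (hw n).sin_eq]
    have he := neg_one_zpow_sq n
    beta_reduce
    generalize (-1 : ℂ) ^ n = e at *
    generalize rcgA k γe γo z0 n = A at *
    generalize Complex.tan (u n) = t at *
    generalize Complex.tan (u (n + 1)) = t' at *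
    generalize rcgZ γe γo z0 n = z at *
    -- Here $YY'+X^2=c^2(1-tt')$ and $Y+Y'=\mathrm ic(t+t')$, using $e^2=1$ and $\mathrm i^2=-1$;
    -- `ht` and `hA` then match the two sides.
    linear_combination
      -(1 - k * jacobiSn k z ^ 2) * (jacobiCn k γe * jacobiDn k γe) * e * c ^ 2 * Complex.I * ht
      - c ^ 2 * Complex.I * e ^ 2 * (1 - t' * t) * hA
      + (1 - k * jacobiSn k γe ^ 2) * (jacobiCn k z * jacobiDn k z) * c ^ 2 *
        ((t * t' + e ^ 2 * (1 - t' * t)) * Complex.I_sq + t * t' * he)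
  · have h2 : (-1 : ℂ) ^ (n + 1) * c = -((-1) ^ n * c) := by rw [neg_one_zpow_add_one]; ring
    simp only [h2]
    exact rcgRelation_of_sn_sq (jacobiSn_sq_add_jacobiCn_sq hγo)
      (jacobiSn_sq_add_jacobiCn_sq (hzhat n).1) hsn (hx2 n)

/-- `s` is a square root `k ^ (1 / 2)` of the modulus. -/
theorem lemma6p1 (k s : ℂ) (hk : 0 < k.re) (hs : s ^ 2 = k) (γe γo z0 : ℂ)
    (hγo : γo = Complex.I * completeEllipticK' k / 2)
    (hγe_reg : JacobiRegularAt k γe)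
    (hz_reg : ∀ n : ℤ, JacobiRegularAt k (rcgZ γe γo z0 n))
    (hzhat_reg : ∀ n : ℤ, JacobiRegularAt k (rcgZ γe γo z0 n + γe + γo)) :
    -- the four explicit solutions
    (IsRCGSolution k γe γo z0 (fun n => (-1) ^ n / s) (fun n => (-1) ^ n / s) ∧
     IsRCGSolution k γe γo z0 (fun n => (-1) ^ n / s) (fun n => (-1) ^ (n + 1) / s) ∧
     IsRCGSolution k γe γo z0 (fun n => (-1) ^ (n + 1) / s) (fun n => (-1) ^ n / s) ∧
     IsRCGSolution k γe γo z0 (fun n => (-1) ^ (n + 1) / s) (fun n => (-1) ^ (n + 1) / s)) ∧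
    -- the solutions through the linear equation `u_{n+1} + u_n = (-1) ^ n arctan A_n`
    (jacobiCn k γe ≠ 0 → jacobiDn k γe ≠ 0 →
      (∀ n : ℤ, 1 - k * jacobiSn k (rcgZ γe γo z0 n) ^ 2 ≠ 0) →
      ∀ u w : ℤ → ℂ, (∀ n : ℤ, Complex.cos (u n) ≠ 0) →
        (∀ n : ℤ, IsArctanValue (rcgA k γe γo z0 n) (w n)) →
        (∀ n : ℤ, u (n + 1) + u n = (-1) ^ n * w n) →
        IsRCGSolution k γe γo z0 (fun n => (-1) ^ n / s)
          (fun n => Complex.I * Complex.tan (u n) / s) ∧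
        IsRCGSolution k γe γo z0 (fun n => (-1) ^ (n + 1) / s)
          (fun n => -(Complex.I * Complex.tan (u n) / s))) := by

  have k0 : k ≠ 0 := by rintro rfl; simp at hk
  have s0 : s ≠ 0 := by rintro rfl; exact k0 (by simpa using hs.symm)
  have hinv : k * s⁻¹ ^ 2 = 1 := by rw [← hs]; field_simp
  constructor
  -- The shift $m\in\{0,1\}$ of the exponent encodes the signs $\varepsilon,\delta$.
  · have alt : ∀ m n : ℤ, (-1 : ℂ) ^ (n + 1 + m) / s = -((-1) ^ (n + m) / s) := fun m n => by
      rw [add_right_comm, neg_one_zpow_add_one, neg_div]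
    have sq : ∀ m : ℤ, k * ((-1 : ℂ) ^ m / s) ^ 2 = 1 := fun m => by
      rw [div_eq_mul_inv, mul_pow, neg_one_zpow_sq, one_mul, hinv]
    have alt0 : ∀ n : ℤ, (-1 : ℂ) ^ (n + 1) / s = -((-1) ^ n / s) := by simpa using alt 0
    exact ⟨isRCGSolution_alternating k0 alt0 alt0 (fun _ => sq _) (fun _ => sq _),
      isRCGSolution_alternating k0 alt0 (alt 1) (fun _ => sq _) (fun _ => sq _),
      isRCGSolution_alternating k0 (alt 1) alt0 (fun _ => sq _) (fun _ => sq _),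
      isRCGSolution_alternating k0 (alt 1) (alt 1) (fun _ => sq _) (fun _ => sq _)⟩
  · intro hcn hdn h1 u w hu hw huw
    obtain ⟨han, hsn⟩ := jacobiSn_half_completeEllipticK' hk
    rw [← hγo] at han hsn
    constructor
    · simp only [div_eq_mul_inv]
      exact isRCGSolution_tan hinv hγe_reg han hsn hz_reg hzhat_reg hcn hdn h1 hu hw huw
    · convert isRCGSolution_tan (c := -s⁻¹) (by rwa [neg_sq]) hγe_reg han hsn hz_reg hzhat_reg hcn
        hdn h1 hu hw huw using 1
      · funext n
        rw [neg_one_zpow_add_one]; ring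
      · funext n
        ring
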